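/- Let $\Bbbk$ be a field and let $G$ be a finite simple graph with non-empty vertex set $V=\{x_1,\dots,x_n\}$ and no isolated vertices. Let $\mathcal C\subseteq V$ be a minimal vertex cover of $G$, that is, a set of vertices that meets every edge of $G$ and has no proper subset with this property. Let $G(\mathcal C)$ be the graph obtained from $G$ by adjoining a new vertex $z$ that is joined to every vertex in $\mathcal C$ and to no other vertex. Let $R=\Bbbk[x_1,\dots,x_n]$ and $S=R[z]$ be the standard graded polynomial rings, and let $I(G)=(x_ix_j : \{x_i,x_j\}\in E(G))\subseteq R$ and $I(G(\mathcal C))=I(G)S+(zx_i : x_i\in\mathcal C)\subseteq S$ be the edge ideals. For a finitely generated graded module $M$ over $R$ or $S$, let $\beta_{i,j}(M)$ be its graded Betti numbers, i.e. the number of basis elements of degree $j$ in homological degree $i$ of a minimal graded free resolution of $M$, and set $$\operatorname{reg} M=\max\{j-i:\beta_{i,j}(M)\neq 0\},\qquad \operatorname{pdim} M=\max\{i:\beta_{i,j}(M)\neq 0\text{ for some }j\}.$$ Then $$\operatorname{reg} S/I(G(\mathcal C))=\operatorname{reg} R/I(G)\qquad\text{and}\qquad \operatorname{pdim} S/I(G(\mathcal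 C))=\operatorname{pdim} R/I(G)+1 .$$ -/

import Mathlib

/-- The graph `G(C)` obtained from `G` by adjoining one new vertex `none` (called `z`) which is
joined exactly to the vertices in `C`. -/
def SimpleGraph.suspension {V : Type*} (G : SimpleGraph V) (C : Set V) :
    SimpleGraph (Option V) where
  Adj
    | some u, some v => G.Adj u v
    | none, some v => v ∈ C
    | some u, none => u ∈ C
    | none, none => False
  symm := ⟨by
    rintro (_ | u) (_ | v) h
    · exact h
    · exact h
    · exact h
    · exact SimpleGraph.Adj.symm h⟩
  loopless := ⟨by
    rintro (_ | u) h
    · exact h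
    · exact G.irrefl h⟩

/-- The edge ideal `(x_i x_j : {i, j} an edge of G)` in the polynomial ring over `k` whose variables
are the vertices of `G`. -/
noncomputable def SimpleGraph.edgeIdeal {V : Type*} (G : SimpleGraph V) (k : Type*) [Field k] :
    Ideal (MvPolynomial V k) :=
  Ideal.span {f | ∃ i j : V, G.Adj i j ∧ f = MvPolynomial.X i * MvPolynomial.X j}

namespace GradedBetti

open MvPolynomial

/-- The grading on the quotient of a standard graded polynomial ring by a (homogeneous) ideal:
the degree `n` part consists of the classes of the homogeneous polynomials of degree `n`. -/
noncomputable def quotientGrading {σ k : Type*} [Field k] (J : Ideal (MvPolynomial σ k)) (n : ℕ) :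
    Submodule k (MvPolynomial σ k ⧸ J) :=
  (homogeneousSubmodule σ k n).map (Ideal.Quotient.mkₐ k J).toLinearMap

/-- A minimal graded free resolution
`⋯ → F₂ → F₁ → F₀ → M → 0`
by free modules of finite rank over the standard graded polynomial ring `k[x_s : s ∈ σ]`, of a
nonnegatively graded module `M` with graded pieces `ℳ n`.  In homological degree `i` the free
module `F i` has a basis of `rank i` homogeneous elements, the `b`-th of them of degree `deg i b`,
so that `F i = ⨁_b R(- deg i b)`. -/
structure MinimalGradedFreeResolution {σ k M : Type*} [Field k] [AddCommGroup M]
    [Module k M] [Module (MvPolynomial σ k) M] (ℳ : ℕ → Submodule k M) where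
  /-- the rank of the free module in homological degree `i` -/
  rank : ℕ → ℕ
  /-- the degrees of the basis elements in homological degree `i` -/
  deg : ∀ i, Fin (rank i) → ℕ
  /-- the differential `F (i + 1) → F i` -/
  d : ∀ i, (Fin (rank (i + 1)) → MvPolynomial σ k) →ₗ[MvPolynomial σ k]
    (Fin (rank i) → MvPolynomial σ k)
  /-- the augmentation `F 0 → M` -/
  aug : (Fin (rank 0) → MvPolynomial σ k) →ₗ[MvPolynomial σ k] M
  /-- The augmentation preserves degrees. -/
  aug_homogeneous : ∀ b, aug (Pi.single b 1) ∈ ℳ (deg 0 b)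
  /-- The differentials preserve degrees: every monomial `x^m` in the `c`-th coordinate of the
  image of the `b`-th basis element satisfies `deg c + |m| = deg b`. -/
  d_homogeneous : ∀ i b c, ∀ m ∈ (d i (Pi.single b 1) c).support,
    deg i c + m.degree = deg (i + 1) b
  aug_surjective : Function.Surjective aug
  exact_zero : Function.Exact (d 0) aug
  exact_succ : ∀ i, Function.Exact (d (i + 1)) (d i)
  /-- Minimality: the image of each differential lies in `(x_s : s ∈ σ) F i`. -/
  minimal : ∀ i b c, constantCoeff (d i (Pi.single b 1) c) = 0

/-- The graded Betti number `β_{i,j}(M)`: the number of basis elements of degree `j` in homological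
degree `i` of a minimal graded free resolution of `M`.  (A finitely generated graded module has such
a resolution, unique up to isomorphism, so the infimum is over a one-element set.) -/
noncomputable def betti {σ k M : Type*} [Field k] [AddCommGroup M]
    [Module k M] [Module (MvPolynomial σ k) M] (ℳ : ℕ → Submodule k M) (i j : ℕ) : ℕ :=
  sInf {r | ∃ F : MinimalGradedFreeResolution (σ := σ) ℳ,
    r = Nat.card {b : Fin (F.rank i) // F.deg i b = j}}

/-- `reg (k[x_s : s ∈ σ] ⧸ J) = r`, that is, `r = max {j - i : β_{i,j} ≠ 0}`
(the maximum exists and is equal to `r`). -/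
def HasRegularity {σ k : Type*} [Field k] (J : Ideal (MvPolynomial σ k)) (r : ℤ) : Prop :=
  IsGreatest {a : ℤ | ∃ i j : ℕ, betti (σ := σ) (quotientGrading J) i j ≠ 0 ∧ a = (j : ℤ) - i} r

/-- `pdim (k[x_s : s ∈ σ] ⧸ J) = p`, that is, `p = max {i : β_{i,j} ≠ 0 for some j}`
(the maximum exists and is equal to `p`). -/
def HasPdim {σ k : Type*} [Field k] (J : Ideal (MvPolynomial σ k)) (p : ℕ) : Prop :=
  IsGreatest {i : ℕ | ∃ j : ℕ, betti (σ := σ) (quotientGrading J) i j ≠ 0} p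

end GradedBetti

/-! Let `I` be the edge ideal of `G` and `P` the prime generated by the variables in `C`, both
extended to `S`. As `C` is a cover, `I ≤ P`, and the edge ideal of the suspension is `I + zP`
(`edgeIdeal_suspension`). Since `z` is a nonzerodivisor modulo `I`, `I ∩ zP = zI`, whence an exact
sequence `0 → I(-1) → I ⊕ P(-1) → I + zP → 0`.

Let `F` be the minimal resolution of `R/I` and `K` the Koszul resolution of `R/P`. The mapping cone
of the sequence gives a resolution of `S/(I + zP)` with modules `F_i ⊕ K_i(-1) ⊕ F_{i-1}(-1)` for `i
≥ 2`, and `F_1 ⊕ K_1(-1)` for `i = 1`. The maps in the cone are multiplication by `z` and a lift `F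
→ K` of `R/I → R/P`. For `i ≥ 1`, `F_i` is generated in degrees at least `i + 1` and `K_i` in degree
`i`, so the lift has no unit entries and the cone is minimal (`exists_resolution_sup`).

Regularity: the copy of `F` contributes the same differences `j - i` as `F`, and `K(-1)` contributes
only `1`, which is at most `reg R/I` because `G` has an edge. Projective dimension: the copy of `F`
reaches one step further than `F`, and `K` is no longer than `F` (`nonempty_index`). The last point
uses minimality of `C`: the product `u` of the variables outside `C` satisfies `u ∉ P` and `uP ≤ I`.
Multiplication by `u` on `K` then factors through `F` up to a homotopy with entries in `P`, so `F_i
= 0` with `K_i ≠ 0` would force `u ∈ P`.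

To read Betti numbers off a resolution, minimal resolutions are shown to exist, to have unique
graded ranks, and to be finite for edge ideals. -/

namespace GradedBetti

open MvPolynomial Matrix

/-! ### Homogeneous polynomials and degree-preserving matrices. -/

section Homogeneous

variable {σ k : Type*} [Field k]

/-- The polynomial `f` is homogeneous of degree `b - a` (and zero if `b < a`). -/
def HomogeneousEntry (a b : ℕ) (f : MvPolynomial σ k) : Prop :=
  ∀ m ∈ f.support, a + m.degree = b

/-- A matrix of polynomials which describes a degree preserving map between free modules whose
bases have the degrees `dc` and `dr`. -/
def HomogeneousMatrix {ι κ : Type*} (dr : ι → ℕ) (dc : κ → ℕ)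
    (M : Matrix ι κ (MvPolynomial σ k)) : Prop :=
  ∀ i j, HomogeneousEntry (dr i) (dc j) (M i j)

/-- The part of degree `j` of a polynomial whose variables have degree one and in which `1` has
degree `a`. -/
noncomputable def shiftComp (a j : ℕ) (f : MvPolynomial σ k) : MvPolynomial σ k :=
  if a ≤ j then homogeneousComponent (j - a) f else 0

theorem coeff_shiftComp (a j : ℕ) (f : MvPolynomial σ k) (m : σ →₀ ℕ) :
    coeff m (shiftComp a j f) = if a + m.degree = j then coeff m f else 0 := by
  unfold shiftComp
  split_ifs with h1 h2 h2
  · rw [coeff_homogeneousComponent, if_pos (by omega)]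
  · rw [coeff_homogeneousComponent, if_neg (by omega)]
  · omega
  · simp

theorem homogeneousEntry_iff {a b : ℕ} {f : MvPolynomial σ k} :
    HomogeneousEntry a b f ↔ ∀ m, coeff m f ≠ 0 → a + m.degree = b := by
  simp only [HomogeneousEntry, mem_support_iff]

theorem homogeneousEntry_zero (a b : ℕ) : HomogeneousEntry a b (0 : MvPolynomial σ k) := by
  simp [HomogeneousEntry]

theorem homogeneousEntry_one (a : ℕ) : HomogeneousEntry a a (1 : MvPolynomial σ k) := by
  classical
  rw [homogeneousEntry_iff]
  intro m hm
  rw [coeff_one] at hm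
  have : m = 0 := by by_contra h; exact hm (if_neg (Ne.symm h))
  simp [this]

theorem HomogeneousEntry.add {a b : ℕ} {f g : MvPolynomial σ k} (hf : HomogeneousEntry a b f)
    (hg : HomogeneousEntry a b g) : HomogeneousEntry a b (f + g) := by
  rw [homogeneousEntry_iff] at *
  intro m hm
  by_cases h : coeff m f = 0
  · exact hg m (by simpa [h] using hm)
  · exact hf m h

theorem HomogeneousEntry.neg {a b : ℕ} {f : MvPolynomial σ k} (hf : HomogeneousEntry a b f) :
    HomogeneousEntry a b (-f) := by
  rw [homogeneousEntry_iff] at *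
  intro m hm
  exact hf m (by simpa using hm)

theorem HomogeneousEntry.shift {a b : ℕ} {f : MvPolynomial σ k} (hf : HomogeneousEntry a b f)
    (s : ℕ) : HomogeneousEntry (a + s) (b + s) f := fun m hm => by
  have := hf m hm; omega

theorem HomogeneousEntry.sum {ι : Type*} {s : Finset ι} {a b : ℕ} {f : ι → MvPolynomial σ k}
    (hf : ∀ i ∈ s, HomogeneousEntry a b (f i)) : HomogeneousEntry a b (∑ i ∈ s, f i) :=
  Finset.sum_induction _ _ (fun _ _ => HomogeneousEntry.add) (homogeneousEntry_zero a b) hf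

theorem HomogeneousEntry.mul {a b c : ℕ} {f g : MvPolynomial σ k} (hf : HomogeneousEntry a b f)
    (hg : HomogeneousEntry b c g) : HomogeneousEntry a c (f * g) := by
  classical
  intro m hm
  obtain ⟨x, hx, y, hy, rfl⟩ := Finset.mem_add.mp (support_mul f g hm)
  have h1 := hf x hx
  have h2 := hg y hy
  rw [map_add]
  omega

theorem homogeneousEntry_shiftComp (a j : ℕ) (f : MvPolynomial σ k) :
    HomogeneousEntry a j (shiftComp a j f) := by
  rw [homogeneousEntry_iff]
  intro m hm
  rw [coeff_shiftComp] at hm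
  by_contra h
  exact hm (if_neg h)

theorem HomogeneousEntry.shiftComp_eq {a b : ℕ} {f : MvPolynomial σ k}
    (hf : HomogeneousEntry a b f) : shiftComp a b f = f := by
  rw [homogeneousEntry_iff] at hf
  ext m
  rw [coeff_shiftComp]
  split_ifs with h
  · rfl
  · by_contra h'
    exact h (hf m (Ne.symm h'))

theorem shiftComp_zero (a j : ℕ) : shiftComp a j (0 : MvPolynomial σ k) = 0 := by
  ext m; simp [coeff_shiftComp]

theorem shiftComp_sum {ι : Type*} (s : Finset ι) (a j : ℕ) (f : ι → MvPolynomial σ k) :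
    shiftComp a j (∑ i ∈ s, f i) = ∑ i ∈ s, shiftComp a j (f i) := by
  ext m
  simp only [coeff_shiftComp, coeff_sum]
  split_ifs <;> simp

theorem HomogeneousEntry.shiftComp_mul {a b : ℕ} {f : MvPolynomial σ k}
    (hf : HomogeneousEntry a b f) (j : ℕ) (g : MvPolynomial σ k) :
    shiftComp a j (f * g) = f * shiftComp b j g := by
  classical
  rw [homogeneousEntry_iff] at hf
  ext m
  rw [coeff_shiftComp, coeff_mul, coeff_mul]
  have key : ∀ x ∈ Finset.HasAntidiagonal.antidiagonal m, coeff x.1 f * coeff x.2 (shiftComp b j g) =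
      if a + m.degree = j then coeff x.1 f * coeff x.2 g else 0 := by
    intro x hx
    by_cases h0 : coeff x.1 f = 0
    · simp [h0]
    have h1 := hf x.1 h0
    have h2 : m.degree = x.1.degree + x.2.degree := by
      rw [← Finset.HasAntidiagonal.mem_antidiagonal.mp hx, map_add]
    rw [coeff_shiftComp]
    split_ifs <;> first | rfl | omega | simp
  rw [Finset.sum_congr rfl key]
  split_ifs <;> simp

theorem HomogeneousMatrix.mul {ι κ μ : Type*} [Fintype κ] {dr : ι → ℕ} {dc : κ → ℕ} {dm : μ → ℕ}
    {M : Matrix ι κ (MvPolynomial σ k)} {N : Matrix κ μ (MvPolynomial σ k)}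
    (hM : HomogeneousMatrix dr dc M) (hN : HomogeneousMatrix dc dm N) :
    HomogeneousMatrix dr dm (M * N) := fun i j =>
  HomogeneousEntry.sum fun c _ => (hM i c).mul (hN c j)

theorem HomogeneousMatrix.shiftComp_mulVec {ι κ : Type*} [Fintype κ] {dr : ι → ℕ} {dc : κ → ℕ}
    {M : Matrix ι κ (MvPolynomial σ k)} (hM : HomogeneousMatrix dr dc M) (j : ℕ)
    (v : κ → MvPolynomial σ k) (i : ι) :
    shiftComp (dr i) j ((M *ᵥ v) i) = (M *ᵥ fun c => shiftComp (dc c) j (v c)) i := by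
  simp only [mulVec, dotProduct, shiftComp_sum]
  exact Finset.sum_congr rfl fun c _ => (hM i c).shiftComp_mul j (v c)

/-- Any solution of a homogeneous linear system can be replaced by its component of the right
degree, because `P` commutes with taking components. -/
theorem HomogeneousMatrix.exists_factor {ι κ μ : Type*} [Fintype κ] {dr : ι → ℕ} {dc : κ → ℕ}
    {dm : μ → ℕ} {P : Matrix ι κ (MvPolynomial σ k)} {X : Matrix ι μ (MvPolynomial σ k)}
    (hP : HomogeneousMatrix dr dc P) (hX : HomogeneousMatrix dr dm X)
    (h : ∀ j, ∃ w, P *ᵥ w = fun i => X i j) :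
    ∃ Y : Matrix κ μ (MvPolynomial σ k), HomogeneousMatrix dc dm Y ∧ P * Y = X := by
  choose w hw using h
  refine ⟨fun c j => shiftComp (dc c) (dm j) (w j c), fun c j => homogeneousEntry_shiftComp _ _ _, ?_⟩
  ext1 i j
  have h1 := hP.shiftComp_mulVec (dm j) (w j) i
  rw [hw j, (hX i j).shiftComp_eq] at h1
  exact h1.symm

end Homogeneous

/-! ### Graded resolutions by matrices, chain maps and uniqueness of minimal ranks. -/

section Resolution

variable {σ k : Type*} [Field k]

/-- A graded complex of finite free modules over a standard graded polynomial ring, given by the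
matrices of its differentials, which is exact in positive homological degrees; it resolves the
cokernel of `D 0`. -/
structure GradedResolution (σ k : Type*) [Field k] where
  /-- the indices of the basis elements -/
  ι : ℕ → Type
  fintype : ∀ i, Fintype (ι i)
  /-- the degrees of the basis elements -/
  deg : ∀ i, ι i → ℕ
  /-- the matrices of the differentials -/
  D : ∀ i, Matrix (ι i) (ι (i + 1)) (MvPolynomial σ k)
  homogeneous : ∀ i, HomogeneousMatrix (deg i) (deg (i + 1)) (D i)
  exact : ∀ i (v : ι (i + 1) → MvPolynomial σ k), D i *ᵥ v = 0 ↔ ∃ w, D (i + 1) *ᵥ w = v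

attribute [instance] GradedResolution.fintype

namespace GradedResolution

/-- All entries of the differentials lie in the irrelevant ideal. -/
def IsMinimal (E : GradedResolution σ k) : Prop :=
  ∀ i c b, constantCoeff (E.D i c b) = 0

/-- The complex resolves `R ⧸ J` with `R` in homological degree zero. -/
def Resolves (E : GradedResolution σ k) (J : Ideal (MvPolynomial σ k)) : Prop :=
  ∃ c₀, (∀ c, c = c₀) ∧ E.deg 0 c₀ = 0 ∧ ∀ f, f ∈ J ↔ ∃ w, (E.D 0 *ᵥ w) c₀ = f

/-- The homogeneous row vector `a` induces an isomorphism from the cokernel of `D 0` to `R ⧸ J`. -/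
def Augments (E : GradedResolution σ k) (J : Ideal (MvPolynomial σ k))
    (a : E.ι 0 → MvPolynomial σ k) : Prop :=
  (∀ c, HomogeneousEntry 0 (E.deg 0 c) (a c)) ∧ (∃ w, a ⬝ᵥ w - 1 ∈ J) ∧
    ∀ v, a ⬝ᵥ v ∈ J ↔ ∃ w, E.D 0 *ᵥ w = v

theorem D_mul_D (E : GradedResolution σ k) (i : ℕ) : E.D i * E.D (i + 1) = 0 := by
  classical
  ext1 c b
  have h := (E.exact i (E.D (i + 1) *ᵥ Pi.single b 1)).mpr ⟨_, rfl⟩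
  rw [mulVec_mulVec, mulVec_single_one] at h
  exact congrFun h c

theorem Resolves.augments {E : GradedResolution σ k} {J : Ideal (MvPolynomial σ k)}
    (h : E.Resolves J) : E.Augments J 1 := by
  obtain ⟨c₀, hu, hd, hJ⟩ := h
  have hs : ∀ v : E.ι 0 → MvPolynomial σ k, 1 ⬝ᵥ v = v c₀ := fun v => by
    simp only [dotProduct, Pi.one_apply, one_mul]
    exact Finset.sum_eq_single_of_mem c₀ (Finset.mem_univ _) fun b _ hb => absurd (hu b) hb
  refine ⟨fun c => ?_, ⟨1, by simp [hs]⟩, fun v => ?_⟩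
  · rw [hu c, hd]
    exact homogeneousEntry_one 0
  · rw [hs, hJ]
    refine exists_congr fun w => ⟨fun h => funext fun c => ?_, fun h => by rw [h]⟩
    rw [hu c, h]

/-- Matrices that form a graded chain map. -/
def IsChainMap (E E' : GradedResolution σ k)
    (φ : ∀ i, Matrix (E'.ι i) (E.ι i) (MvPolynomial σ k)) : Prop :=
  (∀ i, HomogeneousMatrix (E'.deg i) (E.deg i) (φ i)) ∧
    ∀ i, E'.D i * φ (i + 1) = φ i * E.D i

theorem exists_dependent_seq {T : ℕ → Type*} (r : ∀ i, T i → T (i + 1) → Prop)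
    (h : ∀ i x, ∃ y, r i x y) (x₀ : T 0) : ∃ f : ∀ i, T i, f 0 = x₀ ∧ ∀ i, r i (f i) (f (i + 1)) := by
  choose g hg using h
  exact ⟨fun i => Nat.rec x₀ (fun i x => g i x) i, rfl, fun i => hg i _⟩

/-- The comparison theorem: each lift exists because the previous one carries boundaries to
boundaries. -/
theorem exists_isChainMap (E E' : GradedResolution σ k)
    (φ₀ : Matrix (E'.ι 0) (E.ι 0) (MvPolynomial σ k))
    (h₀ : HomogeneousMatrix (E'.deg 0) (E.deg 0) φ₀)
    (h : ∀ v, ∃ w, E'.D 0 *ᵥ w = φ₀ *ᵥ (E.D 0 *ᵥ v)) :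
    ∃ φ, φ 0 = φ₀ ∧ IsChainMap E E' φ := by
  classical
  -- The solvability condition travels with each matrix, so that the recursion can always continue.
  let T : ℕ → Type _ := fun i => {φ : Matrix (E'.ι i) (E.ι i) (MvPolynomial σ k) //
    HomogeneousMatrix (E'.deg i) (E.deg i) φ ∧ ∀ v, ∃ w, E'.D i *ᵥ w = φ *ᵥ (E.D i *ᵥ v)}
  obtain ⟨f, hf0, hf⟩ := exists_dependent_seq (T := T)
    (fun i x y => E'.D i * y.1 = x.1 * E.D i) (fun i x => by
      obtain ⟨y, hy1, hy2⟩ := (E'.homogeneous i).exists_factor (x.2.1.mul (E.homogeneous i))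
        (fun j => by
          obtain ⟨w, hw⟩ := x.2.2 (Pi.single j 1)
          refine ⟨w, ?_⟩
          rw [hw, mulVec_mulVec, mulVec_single_one]
          rfl)
      refine ⟨⟨y, hy1, fun v => (E'.exact i _).mp ?_⟩, hy2⟩
      rw [mulVec_mulVec, mulVec_mulVec, hy2, Matrix.mul_assoc, E.D_mul_D]
      simp) ⟨φ₀, h₀, h⟩
  exact ⟨fun i => (f i).1, congrArg Subtype.val hf0, fun i => (f i).2.1, hf⟩

/-- A chain map that induces zero on the resolved modules is null-homotopic; hence its entries lie
in every ideal that contains the entries of the differentials. -/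
theorem entries_mem_of_null (E E' : GradedResolution σ k)
    (φ : ∀ i, Matrix (E'.ι i) (E.ι i) (MvPolynomial σ k))
    (hφ : ∀ i, E'.D i * φ (i + 1) = φ i * E.D i) (a : Ideal (MvPolynomial σ k))
    (hE : ∀ i c b, E.D i c b ∈ a) (hE' : ∀ i c b, E'.D i c b ∈ a)
    (h₀ : ∀ v, ∃ w, E'.D 0 *ᵥ w = φ 0 *ᵥ v) (i : ℕ) (c : E'.ι i) (b : E.ι i) : φ i c b ∈ a := by
  classical
  have factor : ∀ i (X : Matrix (E'.ι i) (E.ι i) (MvPolynomial σ k)),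
      (∀ v, ∃ w, E'.D i *ᵥ w = X *ᵥ v) →
      ∃ Y : Matrix (E'.ι (i + 1)) (E.ι i) (MvPolynomial σ k), E'.D i * Y = X := fun i X h => by
    choose w hw using fun j => h (Pi.single j 1)
    refine ⟨fun c j => w j c, ?_⟩
    ext1 i j
    have := congrFun (hw j) i
    rw [mulVec_single_one] at this
    exact this
  -- The homotopy is built recursively: once `h` is known in degree `i`, `φ (i + 1) - h * E.D i` is
  -- killed by `E'.D i` and factors through `E'.D (i + 1)`. The remainder after subtracting that
  -- factorization is `h * E.D i`, with entries in `a`.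
  have key : ∀ i, ∃ h : Matrix (E'.ι (i + 1)) (E.ι i) (MvPolynomial σ k),
      (φ i - E'.D i * h) * E.D i = 0 ∧ ∀ c b, (φ i - E'.D i * h) c b ∈ a := by
    intro i
    induction i with
    | zero =>
      obtain ⟨h, hh⟩ := factor 0 (φ 0) h₀
      refine ⟨h, ?_⟩
      rw [hh]
      simp
    | succ i ih =>
      obtain ⟨h, hh, -⟩ := ih
      obtain ⟨h', hh'⟩ := factor (i + 1) (φ (i + 1) - h * E.D i) (fun v => (E'.exact i _).mp (by
        rw [mulVec_mulVec, Matrix.mul_sub, hφ, ← Matrix.mul_assoc, ← Matrix.sub_mul, hh]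
        simp))
      refine ⟨h', ?_⟩
      rw [hh', sub_sub_cancel]
      refine ⟨by rw [Matrix.mul_assoc, E.D_mul_D, Matrix.mul_zero], fun c b => ?_⟩
      exact a.sum_mem fun x _ => a.mul_mem_left _ (hE i x b)
  obtain ⟨h, -, hh⟩ := key i
  have h1 := hh c b
  rw [Matrix.sub_apply] at h1
  rw [← sub_add_cancel (φ i c b) ((E'.D i * h) c b)]
  exact a.add_mem h1 (a.sum_mem fun x _ => a.mul_mem_right _ (hE' i c x))

/-- `ψφ - 1` is null-homotopic and `E` is minimal, so `ψφ` is the identity modulo the irrelevant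
ideal. Over `k` this makes the degree `j` block of `φ` left invertible, and ranks give the
inequality. -/
theorem IsChainMap.card_le {E E' : GradedResolution σ k}
    {φ : ∀ i, Matrix (E'.ι i) (E.ι i) (MvPolynomial σ k)}
    {ψ : ∀ i, Matrix (E.ι i) (E'.ι i) (MvPolynomial σ k)}
    (hφ : IsChainMap E E' φ) (hψ : IsChainMap E' E ψ) (hE : E.IsMinimal)
    (h₀ : ∀ v, ∃ w, E.D 0 *ᵥ w = ψ 0 *ᵥ (φ 0 *ᵥ v) - v) (i j : ℕ) :
    Nat.card {b : E.ι i // E.deg i b = j} ≤ Nat.card {c : E'.ι i // E'.deg i c = j} := by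
  classical
  have hmem := entries_mem_of_null E E (fun i => ψ i * φ i - 1)
    (fun i => by rw [Matrix.mul_sub, Matrix.sub_mul, ← Matrix.mul_assoc, hψ.2, Matrix.mul_assoc,
      hφ.2, Matrix.mul_assoc, Matrix.mul_one, Matrix.one_mul])
    (RingHom.ker (constantCoeff (σ := σ) (R := k))) hE hE
    (fun v => by simpa only [Matrix.sub_mulVec, one_mulVec, ← mulVec_mulVec] using h₀ v) i
  let Φ : Matrix {c : E'.ι i // E'.deg i c = j} {b : E.ι i // E.deg i b = j} k :=
    fun c b => constantCoeff (φ i c b)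
  let Ψ : Matrix {b : E.ι i // E.deg i b = j} {c : E'.ι i // E'.deg i c = j} k :=
    fun b c => constantCoeff (ψ i b c)
  have hone : Ψ * Φ = 1 := by
    ext1 b b'
    have h1 := hmem b b'
    rw [RingHom.mem_ker, Matrix.sub_apply, map_sub, sub_eq_zero, Matrix.mul_apply, map_sum] at h1
    have h2 : constantCoeff ((1 : Matrix (E.ι i) (E.ι i) (MvPolynomial σ k)) b b') =
        (1 : Matrix {b : E.ι i // E.deg i b = j} _ k) b b' := by
      by_cases h : b = b'
      · subst h; simp
      · rw [Matrix.one_apply_ne h, Matrix.one_apply_ne (fun h' => h (Subtype.ext h')), map_zero]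
    rw [← h2, ← h1, Matrix.mul_apply]
    -- Only basis elements of degree `j` contribute: a degree-preserving entry with nonzero constant
    -- term joins equal degrees.
    have h3 : ∀ c, E'.deg i c ≠ j → constantCoeff (ψ i b c * φ i c b') = 0 := fun c hc => by
      have h4 := (hφ.1 i c b')
      rw [homogeneousEntry_iff] at h4
      rw [map_mul]
      refine mul_eq_zero_of_right _ (by_contra fun h5 => hc ?_)
      simpa [b'.2] using h4 0 h5
    simp only [Ψ, Φ, ← map_mul]
    rw [← Fintype.sum_subtype_add_sum_subtype (fun c => E'.deg i c = j)
      (fun c => constantCoeff (ψ i b c * φ i c b'))]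
    rw [Finset.sum_eq_zero (s := Finset.univ (α := {c // ¬ E'.deg i c = j}))
      fun c _ => h3 c c.2, add_zero]
  calc Nat.card {b : E.ι i // E.deg i b = j}
      = (Ψ * Φ).rank := by rw [hone, Matrix.rank_one, Nat.card_eq_fintype_card]
    _ ≤ Φ.rank := Matrix.rank_mul_le_right _ _
    _ ≤ _ := (Matrix.rank_le_card_height _).trans_eq Nat.card_eq_fintype_card.symm

/-- The graded ranks of a minimal resolution are bounded by those of any other resolution. -/
theorem IsMinimal.card_le {E E' : GradedResolution σ k} (hE : E.IsMinimal)
    {J : Ideal (MvPolynomial σ k)} (hJ : ∀ f ∈ J, ∀ n, homogeneousComponent n f ∈ J)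
    {a : E.ι 0 → MvPolynomial σ k} {a' : E'.ι 0 → MvPolynomial σ k}
    (ha : E.Augments J a) (ha' : E'.Augments J a') (i j : ℕ) :
    Nat.card {b : E.ι i // E.deg i b = j} ≤ Nat.card {c : E'.ι i // E'.deg i c = j} := by
  -- A preimage of `1` can be taken homogeneous of degree zero, as `J` is homogeneous. It is needed
  -- because the module in homological degree zero may have any rank.
  have unit : ∀ {E : GradedResolution σ k} {a : E.ι 0 → MvPolynomial σ k}, E.Augments J a →
      ∃ w, (∀ c, HomogeneousEntry (E.deg 0 c) 0 (w c)) ∧ a ⬝ᵥ w - 1 ∈ J := by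
    rintro E a ⟨h1, ⟨w, hw⟩, -⟩
    refine ⟨fun c => shiftComp (E.deg 0 c) 0 (w c), fun c => homogeneousEntry_shiftComp _ _ _, ?_⟩
    convert hJ _ hw 0 using 1
    have h2 : ∀ f : MvPolynomial σ k, homogeneousComponent 0 f = shiftComp 0 0 f := fun f => by
      simp [shiftComp]
    have h3 : homogeneousComponent 0 (1 : MvPolynomial σ k) = 1 := by
      rw [h2, (homogeneousEntry_one 0).shiftComp_eq]
    rw [map_sub, h3, h2, dotProduct, dotProduct, shiftComp_sum]
    congr 1
    exact Finset.sum_congr rfl fun c _ => ((h1 c).shiftComp_mul 0 (w c)).symm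
  -- In degree zero the identity of `R ⧸ J` is lifted by the rank-one map `v ↦ (a ⬝ᵥ v) w`, where
  -- `w` is the chosen preimage of `1`.
  have chain : ∀ {E E' : GradedResolution σ k} {a : E.ι 0 → MvPolynomial σ k}
      {a' : E'.ι 0 → MvPolynomial σ k} {w : E'.ι 0 → MvPolynomial σ k}, E.Augments J a →
      E'.Augments J a' → (∀ c, HomogeneousEntry (E'.deg 0 c) 0 (w c)) →
      ∃ φ, φ 0 = vecMulVec w a ∧ IsChainMap E E' φ := by
    intro E E' a a' w ha ha' hw
    refine exists_isChainMap E E' _ (fun c b => (hw c).mul (ha.1 b)) fun v => ?_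
    rw [← ha'.2.2, vecMulVec_mulVec]
    have h1 := (ha.2.2 (E.D 0 *ᵥ v)).mpr ⟨v, rfl⟩
    rw [op_smul_eq_smul, dotProduct_smul]
    exact J.mul_mem_right _ h1
  obtain ⟨w, hw, hw1⟩ := unit ha
  obtain ⟨w', hw', hw1'⟩ := unit ha'
  obtain ⟨φ, hφ0, hφ⟩ := chain ha ha' hw'
  obtain ⟨ψ, hψ0, hψ⟩ := chain ha' ha hw
  refine hφ.card_le hψ hE (fun v => ?_) i j
  rw [← ha.2.2, hφ0, hψ0]
  simp only [vecMulVec_mulVec, op_smul_eq_smul, dotProduct_smul, dotProduct_sub, smul_eq_mul]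
  have : a ⬝ᵥ v * (a' ⬝ᵥ w') * (a ⬝ᵥ w) - a ⬝ᵥ v =
      (a ⬝ᵥ v) * ((a' ⬝ᵥ w') * (a ⬝ᵥ w - 1) + (a' ⬝ᵥ w' - 1)) := by ring
  rw [this]
  exact J.mul_mem_left _ (J.add_mem (J.mul_mem_left _ hw1) hw1')

end GradedResolution

end Resolution

/-! ### Betti numbers computed from any minimal resolution. -/

section Comparison

variable {σ k : Type*} [Field k]

theorem _root_.Function.Exact.mem_iff {α β γ : Type*} [Zero γ] {f : α → β} {g : β → γ}
    (h : Function.Exact f g) (y : β) : g y = 0 ↔ ∃ x, f x = y := h y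

theorem toMatrix'_entry {ι κ A : Type*} [CommRing A] [Fintype κ] [DecidableEq κ]
    (f : (κ → A) →ₗ[A] (ι → A)) (c : ι) (b : κ) :
    LinearMap.toMatrix' f c b = f (Pi.single b 1) c := by
  have h := congrFun (LinearMap.toMatrix'_mulVec f (Pi.single b 1)) c
  rw [mulVec_single_one] at h
  exact h

/-- A minimal graded free resolution in terms of the matrices of its differentials. -/
noncomputable def MinimalGradedFreeResolution.toGradedResolution {M : Type*} [AddCommGroup M]
    [Module k M] [Module (MvPolynomial σ k) M] {ℳ : ℕ → Submodule k M}
    (F : MinimalGradedFreeResolution (σ := σ) ℳ) : GradedResolution σ k where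
  ι i := Fin (F.rank i)
  fintype _ := inferInstance
  deg := F.deg
  D i := LinearMap.toMatrix' (F.d i)
  homogeneous i c b := by
    rw [toMatrix'_entry]
    exact F.d_homogeneous i b c
  exact i v := by
    simp only [LinearMap.toMatrix'_mulVec]
    exact (F.exact_succ i).mem_iff v

theorem MinimalGradedFreeResolution.isMinimal {M : Type*} [AddCommGroup M]
    [Module k M] [Module (MvPolynomial σ k) M] {ℳ : ℕ → Submodule k M}
    (F : MinimalGradedFreeResolution (σ := σ) ℳ) : F.toGradedResolution.IsMinimal := fun i c b => by
  refine Eq.trans (congrArg _ (toMatrix'_entry (F.d i) c b)) (F.minimal i b c)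

theorem MinimalGradedFreeResolution.exists_augments {J : Ideal (MvPolynomial σ k)}
    (F : MinimalGradedFreeResolution (σ := σ) (quotientGrading J)) :
    ∃ a, F.toGradedResolution.Augments J a := by
  have h := F.aug_homogeneous
  simp only [quotientGrading, Submodule.mem_map] at h
  -- The row `a` consists of homogeneous polynomials representing the images of the basis elements.
  choose a ha ha' using h
  have haug : ∀ v, Ideal.Quotient.mk J (a ⬝ᵥ v) = F.aug v := fun v => by
    conv_rhs => rw [pi_eq_sum_univ v, map_sum]
    simp only [dotProduct, map_sum]
    refine Finset.sum_congr rfl fun b _ => ?_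
    have h1 : F.aug (fun j => if b = j then 1 else 0) = Ideal.Quotient.mk J (a b) := by
      rw [← show F.aug (Pi.single b 1) = Ideal.Quotient.mk J (a b) from (ha' b).symm]
      congr 1
      ext1 j
      simp [Pi.single_apply, eq_comm]
    rw [map_smul, h1, mul_comm]
    rfl
  have hsurj : ∃ w : Fin (F.rank 0) → MvPolynomial σ k, a ⬝ᵥ w - 1 ∈ J := by
    obtain ⟨w, hw⟩ := F.aug_surjective 1
    refine ⟨w, ?_⟩
    rw [← Ideal.Quotient.eq, haug, hw, map_one]
  have hexact : ∀ v : Fin (F.rank 0) → MvPolynomial σ k, a ⬝ᵥ v ∈ J ↔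
      ∃ w, LinearMap.toMatrix' (F.d 0) *ᵥ w = v := fun v => by
    rw [← Ideal.Quotient.eq_zero_iff_mem, haug, F.exact_zero.mem_iff]
    simp only [LinearMap.toMatrix'_mulVec]
  refine ⟨a, fun c m hm => ?_, hsurj, hexact⟩
  have h1 := ha c
  rw [mem_homogeneousSubmodule] at h1
  have h2 := h1 (mem_support_iff.mp hm)
  rw [zero_add, Finsupp.degree_eq_weight_one]
  exact h2

namespace GradedResolution

theorem IsMinimal.exists_minimalGradedFreeResolution {E : GradedResolution σ k} (hE : E.IsMinimal)
    {J : Ideal (MvPolynomial σ k)} (h : E.Resolves J) :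
    ∃ F : MinimalGradedFreeResolution (σ := σ) (quotientGrading J), ∀ i j,
      Nat.card {b : Fin (F.rank i) // F.deg i b = j} = Nat.card {b : E.ι i // E.deg i b = j} := by
  classical
  obtain ⟨c₀, hu, hd, hJ⟩ := h
  let e : ∀ i, E.ι i ≃ Fin (Fintype.card (E.ι i)) := fun i => Fintype.equivFin _
  let D : ∀ i, Matrix (Fin (Fintype.card (E.ι i))) (Fin (Fintype.card (E.ι (i + 1))))
    (MvPolynomial σ k) := fun i => (E.D i).submatrix (e i).symm (e (i + 1)).symm
  have hD : ∀ i v, (D i).mulVecLin v = (E.D i *ᵥ (v ∘ e (i + 1))) ∘ (e i).symm := fun i v => by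
    simp only [D, mulVecLin_apply, submatrix_mulVec_equiv, Equiv.symm_symm]
  have hsingle : ∀ i b c, (D i).mulVecLin (Pi.single b 1) c =
      E.D i ((e i).symm c) ((e (i + 1)).symm b) := fun i b c => by
    rw [mulVecLin_apply, mulVec_single_one]
    rfl
  refine ⟨{
    rank := fun i => Fintype.card (E.ι i)
    deg := fun i b => E.deg i ((e i).symm b)
    d := fun i => (D i).mulVecLin
    aug := (Algebra.linearMap (MvPolynomial σ k) (MvPolynomial σ k ⧸ J)).comp
      (LinearMap.proj (e 0 c₀))
    aug_homogeneous := fun b => ?_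
    d_homogeneous := fun i b c m hm => ?_
    aug_surjective := fun y => ?_
    exact_zero := fun v => ?_
    exact_succ := fun i v => ?_
    minimal := fun i b c => ?_ }, fun i j => ?_⟩
  · rw [← Equiv.apply_symm_apply (e 0) b, hu ((e 0).symm b), Equiv.symm_apply_apply, hd]
    refine ⟨1, isHomogeneous_one _ _, ?_⟩
    simp
  · rw [hsingle] at hm
    exact E.homogeneous i _ _ m hm
  · obtain ⟨f, rfl⟩ := Ideal.Quotient.mk_surjective y
    exact ⟨fun _ => f, rfl⟩
  · have h1 : ((Algebra.linearMap (MvPolynomial σ k) (MvPolynomial σ k ⧸ J)).comp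
      (LinearMap.proj (e 0 c₀))) v = Ideal.Quotient.mk J (v (e 0 c₀)) := rfl
    rw [h1, Ideal.Quotient.eq_zero_iff_mem, hJ, Set.mem_range]
    constructor
    · rintro ⟨w, hw⟩
      refine ⟨w ∘ (e 1).symm, ?_⟩
      rw [hD]
      ext1 c
      obtain ⟨c, rfl⟩ := (e 0).surjective c
      rw [hu c, ← hw]
      simp [Function.comp_assoc]
    · rintro ⟨w, rfl⟩
      refine ⟨w ∘ e 1, ?_⟩
      rw [hD]
      simp
  · rw [hD, Set.mem_range]
    have h1 : (E.D i *ᵥ (v ∘ e (i + 1))) ∘ (e i).symm = 0 ↔ E.D i *ᵥ (v ∘ e (i + 1)) = 0 :=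
      (e i).symm.surjective.injective_comp_right.eq_iff' rfl
    rw [h1, E.exact]
    constructor
    · rintro ⟨w, hw⟩
      refine ⟨w ∘ (e _).symm, ?_⟩
      rw [hD, Function.comp_assoc, Equiv.symm_comp_self, Function.comp_id, hw, Function.comp_assoc,
        Equiv.self_comp_symm, Function.comp_id]
    · rintro ⟨w, rfl⟩
      refine ⟨w ∘ e _, ?_⟩
      rw [hD, Function.comp_assoc, Equiv.symm_comp_self, Function.comp_id]
  · rw [hsingle]
    exact hE i _ _
  · exact Nat.card_congr ((e i).symm.subtypeEquiv fun b => Iff.rfl)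

/-- The infimum is over a singleton: two-sided use of `IsMinimal.card_le` gives uniqueness, and `E`
itself shows that the set is nonempty, without which `sInf` would default to `0`. -/
theorem IsMinimal.betti_eq {E : GradedResolution σ k} (hE : E.IsMinimal)
    {J : Ideal (MvPolynomial σ k)} (hJ : ∀ f ∈ J, ∀ n, homogeneousComponent n f ∈ J)
    (h : E.Resolves J) (i j : ℕ) :
    betti (σ := σ) (quotientGrading J) i j = Nat.card {b : E.ι i // E.deg i b = j} := by
  have key : ∀ F : MinimalGradedFreeResolution (σ := σ) (quotientGrading J),
      Nat.card {b : Fin (F.rank i) // F.deg i b = j} = Nat.card {b : E.ι i // E.deg i b = j} := by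
    intro F
    obtain ⟨a, ha⟩ := F.exists_augments
    exact le_antisymm (F.isMinimal.card_le hJ ha h.augments i j)
      (hE.card_le hJ h.augments ha i j)
  have hset : {r | ∃ F : MinimalGradedFreeResolution (σ := σ) (quotientGrading J),
      r = Nat.card {b : Fin (F.rank i) // F.deg i b = j}} =
      {Nat.card {b : E.ι i // E.deg i b = j}} := by
    ext r
    constructor
    · rintro ⟨F, rfl⟩
      exact key F
    · rintro rfl
      obtain ⟨F, hF⟩ := hE.exists_minimalGradedFreeResolution h
      exact ⟨F, (hF i j).symm⟩
  rw [betti, hset, csInf_singleton]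

theorem IsMinimal.betti_ne_zero_iff {E : GradedResolution σ k} (hE : E.IsMinimal)
    {J : Ideal (MvPolynomial σ k)} (hJ : ∀ f ∈ J, ∀ n, homogeneousComponent n f ∈ J)
    (h : E.Resolves J) (i j : ℕ) :
    betti (σ := σ) (quotientGrading J) i j ≠ 0 ↔ ∃ b, E.deg i b = j := by
  rw [hE.betti_eq hJ h, Ne, Finite.card_eq_zero_iff, not_isEmpty_iff, nonempty_subtype]

end GradedResolution

end Comparison

/-! ### Existence of minimal resolutions. -/

section Existence

variable {σ k : Type*} [Field k]

/-- A submodule of a graded free module that contains the homogeneous components of its elements. -/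
def GradedSubmodule {ι : Type*} (deg : ι → ℕ)
    (N : Submodule (MvPolynomial σ k) (ι → MvPolynomial σ k)) : Prop :=
  ∀ v ∈ N, ∀ j, (fun c => shiftComp (deg c) j (v c)) ∈ N

theorem exists_sum_shiftComp {ι : Type*} [Fintype ι] (deg : ι → ℕ) (v : ι → MvPolynomial σ k) :
    ∃ B, v = ∑ j ∈ Finset.range B, fun c => shiftComp (deg c) j (v c) := by
  -- The sum exceeds every shifted degree that occurs in `v`.
  refine ⟨∑ c, (deg c + (v c).totalDegree) + 1, ?_⟩
  ext c m
  rw [Finset.sum_apply, coeff_sum]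
  simp only [coeff_shiftComp]
  rw [Finset.sum_ite_eq]
  split_ifs with h
  · rfl
  · by_contra h1
    apply h
    have h2 := le_totalDegree (mem_support_iff.mpr h1)
    have h3 := Finset.single_le_sum (f := fun c => deg c + (v c).totalDegree)
      (fun _ _ => Nat.zero_le _) (Finset.mem_univ c)
    rw [Finset.mem_range]
    have h4 : m.degree = m.sum fun _ e => e := rfl
    omega

theorem GradedSubmodule.exists_homogeneous_generators [Finite σ] {ι : Type*} [Fintype ι]
    {deg : ι → ℕ} {N : Submodule (MvPolynomial σ k) (ι → MvPolynomial σ k)}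
    (hN : GradedSubmodule deg N) :
    ∃ (n : ℕ) (deg' : Fin n → ℕ) (X : Matrix ι (Fin n) (MvPolynomial σ k)),
      HomogeneousMatrix deg deg' X ∧ ∀ v, v ∈ N ↔ ∃ w, X *ᵥ w = v := by
  let H : Set (ι → MvPolynomial σ k) :=
    {v | v ∈ N ∧ ∃ j, ∀ c, HomogeneousEntry (deg c) j (v c)}
  have hH : Submodule.span (MvPolynomial σ k) H = N := by
    refine le_antisymm (Submodule.span_le.mpr fun v hv => hv.1) fun v hv => ?_
    obtain ⟨B, hB⟩ := exists_sum_shiftComp deg v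
    rw [hB]
    exact Submodule.sum_mem _ fun j _ => Submodule.subset_span
      ⟨hN v hv j, j, fun c => homogeneousEntry_shiftComp _ _ _⟩
  have hfg : (Submodule.span (MvPolynomial σ k) H).FG := IsNoetherian.noetherian _
  obtain ⟨s, hs, hs'⟩ := (Submodule.fg_span_iff_fg_span_finset_subset H).mp hfg
  rw [hH] at hs'
  choose! d hd using fun v (hv : v ∈ s) => (hs hv).2
  let e := s.equivFin
  let X : Matrix ι (Fin s.card) (MvPolynomial σ k) := Matrix.of fun c b => (e.symm b).1 c
  refine ⟨s.card, fun b => d (e.symm b).1, X,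
    fun c b => hd _ (e.symm b).2 c, fun v => ?_⟩
  have h1 : (s : Set (ι → MvPolynomial σ k)) =
      Set.range X.col := by
    ext v
    constructor
    · intro hv
      exact ⟨e ⟨v, hv⟩, by ext1 c; simp [Matrix.col, X]⟩
    · rintro ⟨b, rfl⟩
      exact (e.symm b).2
  rw [hs', h1, ← range_mulVecLin]
  rfl

/-- A homogeneous generating set of least size has no relation with a unit coefficient, since such a
relation would make a generator redundant. -/
theorem GradedSubmodule.exists_minimal_generators [Finite σ] {ι : Type*} [Fintype ι]
    {deg : ι → ℕ} {N : Submodule (MvPolynomial σ k) (ι → MvPolynomial σ k)}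
    (hN : GradedSubmodule deg N) :
    ∃ (n : ℕ) (deg' : Fin n → ℕ) (X : Matrix ι (Fin n) (MvPolynomial σ k)),
      HomogeneousMatrix deg deg' X ∧ (∀ v, v ∈ N ↔ ∃ w, X *ᵥ w = v) ∧
      ∀ w, X *ᵥ w = 0 → ∀ b, constantCoeff (w b) = 0 := by
  classical
  have hex := hN.exists_homogeneous_generators
  obtain ⟨n, ⟨deg', X, hX, hXN⟩, hmin⟩ := Nat.findX hex
  refine ⟨n, deg', X, hX, hXN, fun w hw b => by_contra fun hb => ?_⟩
  obtain _ | n := n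
  · exact b.elim0
  refine hmin n (by omega) ⟨deg' ∘ b.succAbove, X.submatrix id b.succAbove,
    fun c b' => hX _ _, fun v => ?_⟩
  -- The component of the relation in the degree of generator `b` is again a relation, and its
  -- `b`-th coefficient is exactly a nonzero constant.
  let w' : Fin (n + 1) → MvPolynomial σ k := fun c => shiftComp (deg' c) (deg' b) (w c)
  have hw' : X *ᵥ w' = 0 := by
    ext1 c
    rw [← hX.shiftComp_mulVec, hw]
    exact shiftComp_zero _ _
  have hwb : w' b = C (constantCoeff (w b)) := by
    simp only [w', shiftComp, le_refl, if_true, Nat.sub_self, homogeneousComponent_zero]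
    rfl
  have hsub : ∀ u : Fin (n + 1) → MvPolynomial σ k, u b = 0 →
      X.submatrix id b.succAbove *ᵥ (u ∘ b.succAbove) = X *ᵥ u := fun u hu => by
    ext1 c
    simp only [mulVec, dotProduct]
    rw [Fin.sum_univ_succAbove _ b, hu]
    simp
  rw [hXN]
  constructor
  · rintro ⟨u, rfl⟩
    refine ⟨_, (hsub (u - (u b * C (constantCoeff (w b))⁻¹) • w') ?_).trans ?_⟩
    · rw [Pi.sub_apply, Pi.smul_apply, hwb, smul_eq_mul, mul_assoc, ← C_mul, inv_mul_cancel₀ hb]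
      simp
    · rw [mulVec_sub, mulVec_smul, hw']
      simp
  · rintro ⟨u, rfl⟩
    refine ⟨b.insertNth 0 u, ?_⟩
    rw [← hsub _ (Fin.insertNth_apply_same _ _ _)]
    congr 1
    ext1 c
    simp

/-- A graded free module together with a graded submodule of its irrelevant part. -/
structure GradedSubmoduleData (σ k : Type*) [Field k] where
  /-- the rank -/
  n : ℕ
  /-- the degrees of the basis elements -/
  deg : Fin n → ℕ
  /-- the submodule -/
  N : Submodule (MvPolynomial σ k) (Fin n → MvPolynomial σ k)
  graded : GradedSubmodule deg N
  minimal : ∀ v ∈ N, ∀ b, constantCoeff (v b) = 0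

theorem GradedSubmoduleData.exists_next [Finite σ] (s : GradedSubmoduleData σ k) :
    ∃ (t : GradedSubmoduleData σ k) (X : Matrix (Fin s.n) (Fin t.n) (MvPolynomial σ k)),
      HomogeneousMatrix s.deg t.deg X ∧ (∀ v, v ∈ s.N ↔ ∃ w, X *ᵥ w = v) ∧
      ∀ w, X *ᵥ w = 0 ↔ w ∈ t.N := by
  obtain ⟨n, deg', X, hX, hXN, hmin⟩ := s.graded.exists_minimal_generators
  refine ⟨⟨n, deg', LinearMap.ker X.mulVecLin, fun v hv j => ?_, hmin⟩, X, hX, hXN,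
    fun w => Iff.rfl⟩
  rw [LinearMap.mem_ker, mulVecLin_apply] at hv ⊢
  ext1 c
  rw [← hX.shiftComp_mulVec, hv]
  exact shiftComp_zero _ _

theorem shiftComp_zero_left (j : ℕ) (f : MvPolynomial σ k) :
    shiftComp 0 j f = homogeneousComponent j f := by
  simp [shiftComp]

/-- Syzygies of minimal generators are graded and lie in the irrelevant part of the free module, so
taking minimal generators can be iterated. Properness of `J` starts the iteration: a nonzero
constant term would give a unit in `J`. -/
theorem exists_minimal_resolution [Finite σ] {J : Ideal (MvPolynomial σ k)}
    (hJ : ∀ f ∈ J, ∀ n, homogeneousComponent n f ∈ J) (hJ' : J ≠ ⊤) :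
    ∃ E : GradedResolution σ k, E.IsMinimal ∧ E.Resolves J := by
  choose next X hX hXN hker using fun s : GradedSubmoduleData σ k => s.exists_next
  let s₀ : GradedSubmoduleData σ k :=
    { n := 1
      deg := fun _ => 0
      N := Submodule.comap (LinearMap.proj 0) J
      graded := fun v hv j => by
        rw [Submodule.mem_comap, LinearMap.proj_apply] at hv ⊢
        rw [shiftComp_zero_left]
        exact hJ _ hv j
      minimal := fun v hv b => by
        rw [Submodule.mem_comap, LinearMap.proj_apply] at hv
        by_contra h
        refine hJ' (J.eq_top_of_isUnit_mem (hJ _ hv 0) ?_)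
        rw [homogeneousComponent_zero]
        rw [Subsingleton.elim b 0] at h
        exact (IsUnit.mk0 _ h).map C }
  let s : ℕ → GradedSubmoduleData σ k := fun i => Nat.rec s₀ (fun _ => next) i
  refine ⟨{
    ι := fun i => Fin (s i).n
    fintype := fun _ => inferInstance
    deg := fun i => (s i).deg
    D := fun i => X (s i)
    homogeneous := fun i => hX (s i)
    exact := fun i v => (hker (s i) v).trans (hXN (s (i + 1)) v) }, fun i c b => ?_, ?_⟩
  · have h := (s i).minimal _ ((hXN (s i) (X (s i) *ᵥ Pi.single b 1)).mpr ⟨_, rfl⟩) c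
    rw [mulVec_single_one] at h
    exact h
  · refine ⟨(0 : Fin 1), fun c => Subsingleton.elim (α := Fin 1) c 0, rfl, fun f => ?_⟩
    refine Iff.trans ?_ ((hXN s₀ (fun _ => f)).trans (exists_congr fun w => ?_))
    · exact Iff.rfl
    · constructor
      · intro h
        exact congrFun h (0 : Fin 1)
      · intro h
        ext1 c
        rw [Subsingleton.elim (α := Fin 1) c 0]
        exact h

end Existence

namespace GradedResolution

/-! ### Mapping cones and lifts of multiplication maps. -/

section Cone

variable {σ k : Type*} [Field k]

/-- The indices of the basis elements of a mapping cone. -/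
def ConeIndex (B A : ℕ → Type) : ℕ → Type
  | 0 => B 0
  | i + 1 => B (i + 1) ⊕ A i

/-- The degrees of the basis elements of a mapping cone. -/
def coneDeg (B A : GradedResolution σ k) : ∀ i, ConeIndex B.ι A.ι i → ℕ
  | 0 => B.deg 0
  | i + 1 => Sum.elim (B.deg (i + 1)) (A.deg i)

instance coneFintype (B A : GradedResolution σ k) : ∀ i, Fintype (ConeIndex B.ι A.ι i)
  | 0 => B.fintype 0
  | i + 1 => inferInstanceAs (Fintype (B.ι (i + 1) ⊕ A.ι i))

/-- The differentials of a mapping cone. -/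
noncomputable def coneD (B A : GradedResolution σ k) (φ : ∀ i, Matrix (B.ι i) (A.ι i) (MvPolynomial σ k)) :
    ∀ i, Matrix (ConeIndex B.ι A.ι i) (ConeIndex B.ι A.ι (i + 1)) (MvPolynomial σ k)
  | 0 => fromCols (B.D 0) (φ 0)
  | i + 1 => fromBlocks (B.D (i + 1)) (φ (i + 1)) 0 (-A.D i)

/-- The diagram chase for exactness of the cone: after lifting the `A`-part to `t`, the corrected
`B`-part becomes a cycle. -/
theorem exists_fromBlocks_mulVec {B A : GradedResolution σ k}
    {φ : ∀ i, Matrix (B.ι i) (A.ι i) (MvPolynomial σ k)} (hφ : IsChainMap A B φ) (i : ℕ)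
    (v : B.ι (i + 1) ⊕ A.ι i → MvPolynomial σ k)
    (h : B.D i *ᵥ (v ∘ Sum.inl) + φ i *ᵥ (v ∘ Sum.inr) = 0) (hv : ∃ t, A.D i *ᵥ t = v ∘ Sum.inr) :
    ∃ w, fromBlocks (B.D (i + 1)) (φ (i + 1)) 0 (-A.D i) *ᵥ w = v := by
  obtain ⟨t, ht⟩ := hv
  obtain ⟨w, hw⟩ := (B.exact i (v ∘ Sum.inl - φ (i + 1) *ᵥ (-t))).mp (by
    rw [mulVec_sub, mulVec_mulVec, hφ.2, ← mulVec_mulVec, mulVec_neg, mulVec_neg, sub_neg_eq_add,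
      ht, h])
  refine ⟨Sum.elim w (-t), ?_⟩
  rw [fromBlocks_mulVec, Sum.elim_comp_inl, Sum.elim_comp_inr, hw, sub_add_cancel, zero_mulVec,
    zero_add, mulVec_neg, neg_mulVec, neg_neg, ht, Sum.elim_comp_inl_inr]

theorem mulVec_fromBlocks_mulVec {B A : GradedResolution σ k}
    {φ : ∀ i, Matrix (B.ι i) (A.ι i) (MvPolynomial σ k)} (hφ : IsChainMap A B φ) (i : ℕ)
    (w : B.ι (i + 2) ⊕ A.ι (i + 1) → MvPolynomial σ k) :
    B.D i *ᵥ ((fromBlocks (B.D (i + 1)) (φ (i + 1)) 0 (-A.D i) *ᵥ w) ∘ Sum.inl) +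
      φ i *ᵥ ((fromBlocks (B.D (i + 1)) (φ (i + 1)) 0 (-A.D i) *ᵥ w) ∘ Sum.inr) = 0 := by
  rw [fromBlocks_mulVec, Sum.elim_comp_inl, Sum.elim_comp_inr]
  rw [zero_mulVec, zero_add, mulVec_add, mulVec_mulVec, mulVec_mulVec, B.D_mul_D, hφ.2, neg_mulVec,
    mulVec_neg, mulVec_mulVec]
  simp

theorem fromCols_mulVec_eq_zero_iff {B A : GradedResolution σ k}
    {φ : ∀ i, Matrix (B.ι i) (A.ι i) (MvPolynomial σ k)} (hφ : IsChainMap A B φ)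
    (hinj : ∀ v, (∃ w, B.D 0 *ᵥ w = φ 0 *ᵥ v) → ∃ w, A.D 0 *ᵥ w = v)
    (v : B.ι 1 ⊕ A.ι 0 → MvPolynomial σ k) :
    fromCols (B.D 0) (φ 0) *ᵥ v = 0 ↔ ∃ w, fromBlocks (B.D 1) (φ 1) 0 (-A.D 0) *ᵥ w = v := by
  rw [fromCols_mulVec]
  constructor
  · intro h
    exact exists_fromBlocks_mulVec hφ 0 v h (hinj _ ⟨-(v ∘ Sum.inl), by
      rw [mulVec_neg]; exact neg_eq_of_add_eq_zero_right h⟩)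
  · rintro ⟨w, rfl⟩
    exact mulVec_fromBlocks_mulVec hφ 0 w

theorem fromBlocks_mulVec_eq_zero_iff {B A : GradedResolution σ k}
    {φ : ∀ i, Matrix (B.ι i) (A.ι i) (MvPolynomial σ k)} (hφ : IsChainMap A B φ) (i : ℕ)
    (v : B.ι (i + 2) ⊕ A.ι (i + 1) → MvPolynomial σ k) :
    fromBlocks (B.D (i + 1)) (φ (i + 1)) 0 (-A.D i) *ᵥ v = 0 ↔
      ∃ w, fromBlocks (B.D (i + 2)) (φ (i + 2)) 0 (-A.D (i + 1)) *ᵥ w = v := by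
  constructor
  · intro h
    rw [fromBlocks_mulVec, zero_mulVec, zero_add] at h
    have h1 := congrArg (· ∘ Sum.inl) h
    have h2 := congrArg (· ∘ Sum.inr) h
    simp only [Sum.elim_comp_inl, Sum.elim_comp_inr] at h1 h2
    rw [neg_mulVec] at h2
    exact exists_fromBlocks_mulVec hφ (i + 1) v h1 ((A.exact i _).mp (neg_eq_zero.mp h2))
  · rintro ⟨w, rfl⟩
    rw [fromBlocks_mulVec, mulVec_fromBlocks_mulVec hφ (i + 1) w, fromBlocks_mulVec,
      Sum.elim_comp_inr, zero_mulVec, zero_mulVec, zero_add, zero_add, mulVec_mulVec,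
      Matrix.neg_mul, Matrix.mul_neg, A.D_mul_D, neg_zero, neg_zero, zero_mulVec]
    exact Sum.elim_zero_zero

/-- The mapping cone of a chain map that induces an injection on the resolved modules. -/
noncomputable def cone (B A : GradedResolution σ k) (φ : ∀ i, Matrix (B.ι i) (A.ι i) (MvPolynomial σ k))
    (hφ : IsChainMap A B φ)
    (hinj : ∀ v, (∃ w, B.D 0 *ᵥ w = φ 0 *ᵥ v) → ∃ w, A.D 0 *ᵥ w = v) : GradedResolution σ k where
  ι := ConeIndex B.ι A.ι
  fintype := coneFintype B A
  deg := coneDeg B A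
  D := coneD B A φ
  homogeneous i := by
    obtain _ | i := i
    · rintro c (b | b)
      · exact B.homogeneous 0 c b
      · exact hφ.1 0 c b
    · rintro (c | c) (b | b)
      · exact B.homogeneous (i + 1) c b
      · exact hφ.1 (i + 1) c b
      · exact homogeneousEntry_zero _ _
      · exact (A.homogeneous i c b).neg
  exact i v := match i with
    | 0 => fromCols_mulVec_eq_zero_iff hφ hinj v
    | i + 1 => fromBlocks_mulVec_eq_zero_iff hφ i v

theorem cone_D_zero_mulVec (B A : GradedResolution σ k)
    (φ : ∀ i, Matrix (B.ι i) (A.ι i) (MvPolynomial σ k)) (hφ : IsChainMap A B φ)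
    (hinj : ∀ v, (∃ w, B.D 0 *ᵥ w = φ 0 *ᵥ v) → ∃ w, A.D 0 *ᵥ w = v)
    (w : B.ι 1 → MvPolynomial σ k) (u : A.ι 0 → MvPolynomial σ k) :
    (cone B A φ hφ hinj).D 0 *ᵥ Sum.elim w u = B.D 0 *ᵥ w + φ 0 *ᵥ u :=
  fromCols_mulVec_sumElim _ _ _ _

theorem Resolves.resolves_cone {B A : GradedResolution σ k}
    {φ : ∀ i, Matrix (B.ι i) (A.ι i) (MvPolynomial σ k)} {hφ : IsChainMap A B φ}
    {hinj : ∀ v, (∃ w, B.D 0 *ᵥ w = φ 0 *ᵥ v) → ∃ w, A.D 0 *ᵥ w = v}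
    {I J : Ideal (MvPolynomial σ k)} (hB : B.Resolves I)
    (hJ : ∀ c f, f ∈ J ↔ ∃ g ∈ I, ∃ u, g + (φ 0 *ᵥ u) c = f) :
    (cone B A φ hφ hinj).Resolves J := by
  obtain ⟨c₀, hu, hd, hI⟩ := hB
  refine ⟨c₀, hu, hd, fun f => (hJ c₀ f).trans ?_⟩
  constructor
  · rintro ⟨g, hg, u, rfl⟩
    obtain ⟨w, rfl⟩ := (hI g).mp hg
    exact ⟨Sum.elim w u, congrFun (cone_D_zero_mulVec _ _ _ _ _ w u) c₀⟩
  · rintro ⟨w, rfl⟩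
    obtain ⟨w, u, rfl⟩ : ∃ w' u', w = Sum.elim w' u' := ⟨_, _, (Sum.elim_comp_inl_inr w).symm⟩
    exact ⟨(B.D 0 *ᵥ w) c₀, (hI _).mpr ⟨_, rfl⟩, u,
      (congrFun (cone_D_zero_mulVec B A φ hφ hinj w u) c₀).symm⟩

/-- Raise all degrees by `s`. -/
@[reducible] def shift (E : GradedResolution σ k) (s : ℕ) : GradedResolution σ k where
  ι := E.ι
  fintype := E.fintype
  deg i b := E.deg i b + s
  D := E.D
  homogeneous i c b := (E.homogeneous i c b).shift s
  exact := E.exact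

/-- The indices of the basis elements of the polynomial ring as a complex. -/
def UnitIndex : ℕ → Type
  | 0 => Unit
  | _ + 1 => Empty

instance : ∀ i, Fintype (UnitIndex i)
  | 0 => inferInstanceAs (Fintype Unit)
  | _ + 1 => inferInstanceAs (Fintype Empty)

instance (i : ℕ) : IsEmpty (UnitIndex (i + 1)) := inferInstanceAs (IsEmpty Empty)

variable (σ k) in
/-- The resolution of the polynomial ring as a module over itself. -/
noncomputable def unit : GradedResolution σ k where
  ι := UnitIndex
  fintype := inferInstance
  deg _ _ := 0
  D _ := 0
  homogeneous _ _ b := isEmptyElim b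
  exact i v := by
    rw [zero_mulVec]
    exact ⟨fun _ => ⟨0, Subsingleton.elim _ _⟩, fun _ => rfl⟩

theorem resolves_unit : (unit σ k).Resolves ⊥ := by
  refine ⟨(), fun _ => rfl, rfl, fun f => ?_⟩
  have h : ∀ w, ((0 : Matrix (UnitIndex 0) (UnitIndex 1) (MvPolynomial σ k)) *ᵥ w) () = 0 :=
    fun w => congrFun (zero_mulVec w) ()
  exact ⟨fun hf => ⟨0, (h 0).trans (Ideal.mem_bot.mp hf).symm⟩,
    fun ⟨w, hw⟩ => Ideal.mem_bot.mpr (hw.symm.trans (h w))⟩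

theorem Resolves.one_dotProduct_eq {E : GradedResolution σ k} {I : Ideal (MvPolynomial σ k)}
    (hE : E.Resolves I) (c : E.ι 0) (v : E.ι 0 → MvPolynomial σ k) : 1 ⬝ᵥ v = v c := by
  obtain ⟨c₀, hu, -⟩ := hE
  rw [hu c, one_dotProduct]
  exact Finset.sum_eq_single_of_mem c₀ (Finset.mem_univ _) fun b _ hb => absurd (hu b) hb

theorem Resolves.mem_iff {E : GradedResolution σ k} {I : Ideal (MvPolynomial σ k)}
    (hE : E.Resolves I) (c : E.ι 0) (v : E.ι 0 → MvPolynomial σ k) :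
    v c ∈ I ↔ ∃ w, E.D 0 *ᵥ w = v := by
  rw [← hE.augments.2.2, hE.one_dotProduct_eq c]

theorem Resolves.deg_zero {E : GradedResolution σ k} {I : Ideal (MvPolynomial σ k)}
    (hE : E.Resolves I) (c : E.ι 0) : E.deg 0 c = 0 := by
  obtain ⟨c₀, hu, hd, -⟩ := hE
  rw [hu c, hd]

theorem Resolves.exists_index {E : GradedResolution σ k} {I : Ideal (MvPolynomial σ k)}
    (hE : E.Resolves I) : ∃ c₀ : E.ι 0, ∀ c, c = c₀ := by
  obtain ⟨c₀, hu, -⟩ := hE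
  exact ⟨c₀, hu⟩

theorem Resolves.const_mulVec {κ : Type*} {E : GradedResolution σ k} {I : Ideal (MvPolynomial σ k)}
    (hE : E.Resolves I) (m : MvPolynomial σ k) (c : E.ι 0) (v : E.ι 0 → MvPolynomial σ k) (i : κ) :
    (Matrix.of (fun (_ : κ) (_ : E.ι 0) => m) *ᵥ v) i = m * v c := by
  rw [← hE.one_dotProduct_eq c v, one_dotProduct, Finset.mul_sum]
  rfl

/-- A lift of multiplication by a homogeneous polynomial `m` with `m I' ≤ I`. -/
theorem Resolves.exists_lift {E E' : GradedResolution σ k} {I I' : Ideal (MvPolynomial σ k)}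
    (hE : E.Resolves I) (hE' : E'.Resolves I') {m : MvPolynomial σ k} {s : ℕ}
    (hm : HomogeneousEntry 0 s m) (hI' : ∀ f ∈ I', m * f ∈ I) :
    ∃ φ : ∀ i, Matrix (E.ι i) (E'.ι i) (MvPolynomial σ k),
      φ 0 = Matrix.of (fun _ _ => m) ∧ IsChainMap (E'.shift s) E φ := by
  obtain ⟨c, -⟩ := hE.exists_index
  obtain ⟨c', -⟩ := hE'.exists_index
  refine exists_isChainMap (E'.shift s) E _ (fun i j => ?_) fun v => ?_
  · rw [hE.deg_zero]
    have h : (E'.shift s).deg 0 j = s := by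
      change E'.deg 0 j + s = s
      rw [hE'.deg_zero, zero_add]
    rw [h]
    exact hm
  · rw [← hE.mem_iff c]
    have h := hE'.const_mulVec m c' (E'.D 0 *ᵥ v) c
    refine (congrArg (· ∈ I) h).mpr (hI' _ ?_)
    exact (hE'.mem_iff c' _).mpr ⟨v, rfl⟩

/-- With `I' = (I : m)`, multiplication by `m` embeds `R/I'(-s)` in `R/I` with cokernel `R/(I +
(m))`. -/
theorem Resolves.exists_cone {E E' : GradedResolution σ k} {I I' : Ideal (MvPolynomial σ k)}
    (hE : E.Resolves I) (hE' : E'.Resolves I') {m : MvPolynomial σ k} {s : ℕ}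
    (hm : HomogeneousEntry 0 s m) (hI' : ∀ f, f ∈ I' ↔ m * f ∈ I) :
    ∃ φ hφ hinj, (cone E (E'.shift s) φ hφ hinj).Resolves (I ⊔ Ideal.span {m}) := by
  obtain ⟨c, -⟩ := hE.exists_index
  obtain ⟨c', -⟩ := hE'.exists_index
  obtain ⟨φ, hφ0, hφ⟩ := hE.exists_lift hE' hm fun f hf => (hI' f).mp hf
  have h0 : ∀ (u : (E'.shift s).ι 0 → MvPolynomial σ k) (i), (φ 0 *ᵥ u) i = m * u c' :=
    fun u i => by
      rw [hφ0]
      exact hE'.const_mulVec m c' u i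
  refine ⟨φ, hφ, fun v hv => ?_, hE.resolves_cone fun i f => ?_⟩
  · have h1 := (hE.mem_iff c _).mpr hv
    rw [h0, ← hI'] at h1
    exact (hE'.mem_iff c' v).mp h1
  · simp only [h0]
    rw [Submodule.mem_sup]
    refine exists_congr fun g => and_congr_right fun _ => ?_
    constructor
    · rintro ⟨y, hy, rfl⟩
      obtain ⟨a, rfl⟩ := Ideal.mem_span_singleton'.mp hy
      exact ⟨fun _ => a, by rw [mul_comm]⟩
    · rintro ⟨u, rfl⟩
      exact ⟨m * u c', Ideal.mul_mem_right _ _ (Ideal.mem_span_singleton_self m), rfl⟩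

end Cone

/-! ### Finite resolutions of monomial ideals and the Koszul complex. -/

section Monomial

variable {σ k : Type*} [Field k]

theorem homogeneousEntry_monomial (t : σ →₀ ℕ) (r : k) :
    HomogeneousEntry 0 t.degree (monomial t r) := by
  classical
  intro m hm
  rw [zero_add, Finset.mem_singleton.mp (support_monomial_subset hm)]

variable (k) in
-- Remove one monomial `t` and take a cone: the colon of the remaining ideal by `t` is generated by
-- the truncated differences `a - t`. There may be coincidences among these, hence the bound `T.card
-- ≤ n` in place of an equality.
theorem exists_finite_resolution (n : ℕ) : ∀ T : Finset (σ →₀ ℕ), T.card ≤ n →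
    ∃ (E : GradedResolution σ k) (N : ℕ),
      E.Resolves (Ideal.span ((fun t => monomial t 1) '' (T : Set (σ →₀ ℕ)))) ∧
      ∀ i, N < i → IsEmpty (E.ι i) := by
  classical
  induction n with
  | zero =>
    intro T hT
    obtain rfl := Finset.card_eq_zero.mp (Nat.le_zero.mp hT)
    refine ⟨unit σ k, 0, ?_, ?_⟩
    · simpa using resolves_unit
    · rintro (_ | i) hi
      · omega
      · exact inferInstanceAs (IsEmpty (UnitIndex (i + 1)))
  | succ n ih =>
    intro T hT
    obtain rfl | ⟨t, ht⟩ := T.eq_empty_or_nonempty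
    · exact ih ∅ (by simp)
    have hcard := Finset.card_erase_of_mem ht
    obtain ⟨E, N, hE, hN⟩ := ih (T.erase t) (by omega)
    obtain ⟨E', N', hE', hN'⟩ := ih ((T.erase t).image (· - t))
      (Finset.card_image_le.trans (by omega))
    obtain ⟨φ, hφ, hinj, hcone⟩ := hE.exists_cone hE' (homogeneousEntry_monomial t 1) (fun f => by
      simp only [mem_ideal_span_monomial_image, Finset.mem_coe, Finset.mem_image,
        exists_exists_and_eq_and]
      constructor
      · intro h m hm
        rw [mem_support_iff, coeff_monomial_mul'] at hm
        split_ifs at hm with h1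
        · rw [one_mul] at hm
          obtain ⟨a, ha, hle⟩ := h _ (mem_support_iff.mpr hm)
          refine ⟨a, ha, ?_⟩
          intro x
          have h2 := hle x
          have h3 := h1 x
          simp only [Finsupp.coe_tsub, Pi.sub_apply] at h2
          omega
        · exact absurd rfl hm
      · intro h m hm
        obtain ⟨a, ha, hle⟩ := h (t + m) (by
          rw [mem_support_iff, coeff_monomial_mul, one_mul]
          exact mem_support_iff.mp hm)
        exact ⟨a, ha, tsub_le_iff_left.mpr hle⟩)
    refine ⟨cone E (E'.shift _) φ hφ hinj, max N N' + 1, ?_, ?_⟩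
    · convert hcone using 1
      conv_lhs => rw [← Finset.insert_erase ht, Finset.coe_insert, Set.image_insert_eq]
      rw [← Ideal.span_union, Set.union_singleton]
    · rintro (_ | i) hi
      · omega
      · have := hN (i + 1) (by omega)
        have := hN' i (by omega)
        exact inferInstanceAs (IsEmpty (E.ι (i + 1) ⊕ E'.ι i))

theorem mem_span_X_of_mul {C : Set σ} {v : σ} (hv : v ∉ C) {f : MvPolynomial σ k}
    (h : X v * f ∈ Ideal.span (X '' C)) : f ∈ Ideal.span (X '' C : Set (MvPolynomial σ k)) := by
  classical
  rw [mem_ideal_span_X_image] at *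
  intro m hm
  obtain ⟨i, hi, hi'⟩ := h (Finsupp.single v 1 + m) (by
    rw [mem_support_iff, coeff_X_mul]
    exact mem_support_iff.mp hm)
  refine ⟨i, hi, ?_⟩
  rwa [Finsupp.add_apply, Finsupp.single_eq_of_ne (by rintro rfl; exact hv hi), zero_add] at hi'

variable (k) in
/-- The Koszul complex on a set of variables. -/
theorem exists_koszul (C : Finset σ) :
    ∃ K : GradedResolution σ k, K.Resolves (Ideal.span (X '' (C : Set σ))) ∧
      (∀ i b, K.deg i b = i) ∧ ∀ i c b, K.D i c b ∈ Ideal.span (X '' (C : Set σ)) := by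
  classical
  induction C using Finset.induction_on with
  | empty =>
    refine ⟨unit σ k, by simpa using resolves_unit, ?_, fun i c b => isEmptyElim (α := UnitIndex (i + 1)) b⟩
    rintro (_ | i) b
    · rfl
    · exact isEmptyElim (α := UnitIndex (i + 1)) b
  | insert v C hv ih =>
    obtain ⟨K, hK, hdeg, hD⟩ := ih
    obtain ⟨c, hc⟩ := hK.exists_index
    have hX : HomogeneousEntry 0 1 (X v : MvPolynomial σ k) := by
      have h := homogeneousEntry_monomial (Finsupp.single v 1) (1 : k)
      rwa [Finsupp.degree_single] at h
    -- Multiplication by `X v` is its own lift to `K`, and its cone is the next Koszul complex.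
    let φ : ∀ i, Matrix (K.ι i) ((K.shift 1).ι i) (MvPolynomial σ k) :=
      fun i => (X v : MvPolynomial σ k) • (1 : Matrix (K.ι i) (K.ι i) _)
    have hle : Ideal.span (X '' (C : Set σ)) ≤
        (Ideal.span (X '' ((insert v C : Finset σ) : Set σ)) : Ideal (MvPolynomial σ k)) :=
      Ideal.span_mono (Set.image_mono (by simp))
    have hentry : ∀ i (a b : K.ι i), φ i a b = if a = b then X v else 0 := fun i a b => by
      change X v * (1 : Matrix (K.ι i) (K.ι i) (MvPolynomial σ k)) a b = _
      rw [Matrix.one_apply, mul_ite, mul_one, mul_zero]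
    have hφ : IsChainMap (K.shift 1) K φ := by
      refine ⟨fun i a b => ?_, fun i => ?_⟩
      · rw [hentry]
        split_ifs with h
        · have h1 := hX.shift (K.deg i a)
          rw [zero_add, add_comm] at h1
          rw [← h]
          exact h1
        · exact homogeneousEntry_zero _ _
      · exact (Matrix.mul_smul _ _ _).trans ((congrArg _ ((Matrix.mul_one _).trans
          (Matrix.one_mul _).symm)).trans (Matrix.smul_mul _ _ _).symm)
    have hφ0 : ∀ (u : K.ι 0 → MvPolynomial σ k) i, (φ 0 *ᵥ u) i = X v * u i := fun u i => by
      have h : φ 0 *ᵥ u = (X v : MvPolynomial σ k) • u :=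
        (smul_mulVec _ _ _).trans (congrArg _ (one_mulVec _))
      rw [h, Pi.smul_apply, smul_eq_mul]
    refine ⟨cone K (K.shift 1) φ hφ fun w hw => ?_, hK.resolves_cone fun i f => ?_, ?_, ?_⟩
    · have h1 := (hK.mem_iff c _).mpr hw
      rw [hφ0] at h1
      exact (hK.mem_iff c w).mp (mem_span_X_of_mul hv h1)
    · simp only [hφ0]
      rw [Finset.coe_insert, Set.image_insert_eq, Ideal.span_insert, sup_comm, Submodule.mem_sup]
      refine exists_congr fun g => and_congr_right fun _ => ?_
      constructor
      · rintro ⟨y, hy, rfl⟩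
        obtain ⟨a, rfl⟩ := Ideal.mem_span_singleton'.mp hy
        exact ⟨fun _ => a, by rw [mul_comm]⟩
      · rintro ⟨u, rfl⟩
        exact ⟨_, Ideal.mul_mem_right _ _ (Ideal.mem_span_singleton_self _), rfl⟩
    · rintro (_ | i) b
      · exact hdeg 0 b
      · obtain b | b := b
        · exact hdeg (i + 1) b
        · exact congrArg (· + 1) (hdeg i b)
    · have hXmem : (X v : MvPolynomial σ k) ∈
          Ideal.span (X '' ((insert v C : Finset σ) : Set σ)) :=
        Ideal.subset_span ⟨v, by simp, rfl⟩
      rintro (_ | i) a (b | b)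
      · exact hle (hD 0 a b)
      · exact Ideal.mul_mem_right _ _ hXmem
      · obtain a | a := a
        · exact hle (hD (i + 1) a b)
        · exact Ideal.zero_mem _
      · obtain a | a := a
        · exact Ideal.mul_mem_right _ _ hXmem
        · exact neg_mem (hle (hD i a b))

end Monomial

end GradedResolution

namespace GradedResolution

/-! ### Truncation, direct sum and extension of resolutions. -/

section Constructions

variable {σ k : Type*} [Field k]

/-- Drop the module in homological degree zero. -/
@[reducible] def tail (E : GradedResolution σ k) : GradedResolution σ k where
  ι i := E.ι (i + 1)
  fintype i := E.fintype (i + 1)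
  deg i := E.deg (i + 1)
  D i := E.D (i + 1)
  homogeneous i := E.homogeneous (i + 1)
  exact i := E.exact (i + 1)

/-- The direct sum of two resolutions. -/
@[reducible] noncomputable def sum (E E' : GradedResolution σ k) : GradedResolution σ k where
  ι i := E.ι i ⊕ E'.ι i
  fintype _ := inferInstance
  deg i := Sum.elim (E.deg i) (E'.deg i)
  D i := fromBlocks (E.D i) 0 0 (E'.D i)
  homogeneous i := by
    rintro (c | c) (b | b)
    · exact E.homogeneous i c b
    · exact homogeneousEntry_zero _ _
    · exact homogeneousEntry_zero _ _
    · exact E'.homogeneous i c b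
  exact i v := by
    obtain ⟨v, v', rfl⟩ : ∃ a b, v = Sum.elim a b := ⟨_, _, (Sum.elim_comp_inl_inr v).symm⟩
    simp only [fromBlocks_mulVec, zero_mulVec, zero_add, add_zero, Sum.elim_comp_inl,
      Sum.elim_comp_inr]
    have h0 : ∀ (x : E.ι i → MvPolynomial σ k) (y : E'.ι i → MvPolynomial σ k),
        Sum.elim x y = 0 ↔ x = 0 ∧ y = 0 := fun x y => by
      rw [← Sum.elim_zero_zero, Sum.elim_eq_iff]
    rw [h0, E.exact, E'.exact]
    constructor
    · rintro ⟨⟨w, rfl⟩, w', rfl⟩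
      exact ⟨Sum.elim w w', by simp⟩
    · rintro ⟨w, hw⟩
      rw [Sum.elim_eq_iff] at hw
      exact ⟨⟨_, hw.1⟩, _, hw.2⟩

/-- The indices of a complex that is extended by one module. -/
def ConsIndex (ι₀ : Type) (ι : ℕ → Type) : ℕ → Type
  | 0 => ι₀
  | i + 1 => ι i

/-- Extend a resolution by a module in homological degree zero. -/
noncomputable def cons (E : GradedResolution σ k) {ι₀ : Type} (h : Fintype ι₀) (deg₀ : ι₀ → ℕ)
    (D₀ : Matrix ι₀ (E.ι 0) (MvPolynomial σ k)) (hD₀ : HomogeneousMatrix deg₀ (E.deg 0) D₀)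
    (hexact : ∀ v, D₀ *ᵥ v = 0 ↔ ∃ w, E.D 0 *ᵥ w = v) : GradedResolution σ k where
  ι := ConsIndex ι₀ E.ι
  fintype i := match i with
    | 0 => h
    | i + 1 => E.fintype i
  deg i := match i with
    | 0 => deg₀
    | i + 1 => E.deg i
  D i := match i with
    | 0 => D₀
    | i + 1 => E.D i
  homogeneous i := match i with
    | 0 => hD₀
    | i + 1 => E.homogeneous i
  exact i := match i with
    | 0 => hexact
    | i + 1 => E.exact i

end Constructions

/-! ### Adjoining the variable `z`. -/

section Extension

variable {V k : Type*} [Field k]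

theorem optionEquivLeft_rename (f : MvPolynomial V k) :
    optionEquivLeft k V (rename some f) = Polynomial.C f := by
  induction f using MvPolynomial.induction_on with
  | C a => rw [rename_C, optionEquivLeft_C]
  | add p q hp hq => rw [map_add, map_add, hp, hq, map_add]
  | mul_X p v hp => rw [map_mul, map_mul, hp, rename_X, optionEquivLeft_X_some, map_mul]

/-- The ideal generated by `I` after adjoining a variable. -/
noncomputable def extend (I : Ideal (MvPolynomial V k)) : Ideal (MvPolynomial (Option V) k) :=
  (I.map Polynomial.C).comap (optionEquivLeft k V)

theorem mem_extend {I : Ideal (MvPolynomial V k)} {f : MvPolynomial (Option V) k} :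
    f ∈ extend I ↔ ∀ n, (optionEquivLeft k V f).coeff n ∈ I := by
  rw [extend, Ideal.mem_comap, Ideal.mem_map_C_iff]

theorem rename_mem_extend {I : Ideal (MvPolynomial V k)} {f : MvPolynomial V k} (hf : f ∈ I) :
    rename some f ∈ extend I := by
  rw [extend, Ideal.mem_comap, optionEquivLeft_rename]
  exact Ideal.mem_map_of_mem _ hf

theorem extend_le {I : Ideal (MvPolynomial V k)} {J : Ideal (MvPolynomial (Option V) k)}
    (h : ∀ f ∈ I, rename some f ∈ J) : extend I ≤ J := by
  intro f hf
  rw [mem_extend] at hf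
  rw [← (optionEquivLeft k V).symm_apply_apply f,
    (optionEquivLeft k V f).as_sum_range_C_mul_X_pow, map_sum]
  refine J.sum_mem fun n _ => ?_
  rw [map_mul]
  refine J.mul_mem_right _ ?_
  rw [← optionEquivLeft_rename, AlgEquiv.symm_apply_apply]
  exact h _ (hf n)

theorem mem_extend_of_X_mul {I : Ideal (MvPolynomial V k)} {f : MvPolynomial (Option V) k}
    (h : X none * f ∈ extend I) : f ∈ extend I := by
  rw [mem_extend] at *
  intro n
  have h1 := h (n + 1)
  rwa [map_mul, optionEquivLeft_X_none, Polynomial.coeff_X_mul] at h1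

theorem coeff_map_mulVec {ι κ : Type*} [Fintype κ] (M : Matrix ι κ (MvPolynomial V k))
    (v : κ → MvPolynomial (Option V) k) (c : ι) (n : ℕ) :
    (optionEquivLeft k V ((M.map (rename some) *ᵥ v) c)).coeff n =
      (M *ᵥ fun b => (optionEquivLeft k V (v b)).coeff n) c := by
  simp only [mulVec, dotProduct, map_sum, map_mul, map_apply, optionEquivLeft_rename,
    Polynomial.finsetSum_coeff, Polynomial.coeff_C_mul]

theorem map_mulVec_eq_iff {ι κ : Type*} [Fintype κ] (M : Matrix ι κ (MvPolynomial V k))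
    (v : κ → MvPolynomial (Option V) k) (u : ι → MvPolynomial (Option V) k) :
    M.map (rename some) *ᵥ v = u ↔ ∀ n,
      (M *ᵥ fun b => (optionEquivLeft k V (v b)).coeff n) =
        fun c => (optionEquivLeft k V (u c)).coeff n := by
  constructor
  · rintro rfl n
    ext1 c
    rw [coeff_map_mulVec]
  · intro h
    ext1 c
    apply (optionEquivLeft k V).injective
    ext1 n
    rw [coeff_map_mulVec]
    exact congrFun (h n) c

/-- The matrix does not involve the new variable, so the system decouples over powers of `z`. This
is the flatness that makes base change exact. -/
theorem exists_map_mulVec_iff {ι κ : Type*} [Fintype ι] [Fintype κ]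
    (M : Matrix ι κ (MvPolynomial V k)) (u : ι → MvPolynomial (Option V) k) :
    (∃ v, M.map (rename some) *ᵥ v = u) ↔
      ∀ n, ∃ w, M *ᵥ w = fun c => (optionEquivLeft k V (u c)).coeff n := by
  simp only [map_mulVec_eq_iff]
  refine ⟨fun ⟨v, hv⟩ n => ⟨_, hv n⟩, fun h => ?_⟩
  choose w hw using h
  -- Beyond this power all coefficients of `u` vanish, so a finite sum of the chosen solutions
  -- suffices.
  let N := ∑ c, (optionEquivLeft k V (u c)).natDegree + 1
  refine ⟨fun b => (optionEquivLeft k V).symm (∑ n ∈ Finset.range N, Polynomial.monomial n (w n b)),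
    fun n => ?_⟩
  simp only [AlgEquiv.apply_symm_apply, Polynomial.finsetSum_coeff, Polynomial.coeff_monomial,
    Finset.sum_ite_eq', Finset.mem_range]
  split_ifs with hn
  · exact hw n
  · ext1 c
    rw [Polynomial.coeff_eq_zero_of_natDegree_lt]
    · exact congrFun (mulVec_zero M) c
    · have := Finset.single_le_sum (f := fun c => (optionEquivLeft k V (u c)).natDegree)
        (fun _ _ => Nat.zero_le _) (Finset.mem_univ c)
      simp only [N] at hn
      omega

theorem _root_.GradedBetti.HomogeneousEntry.rename_some {a b : ℕ} {f : MvPolynomial V k}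
    (hf : HomogeneousEntry a b f) : HomogeneousEntry a b (rename some f) := by
  classical
  intro m hm
  rw [support_rename_of_injective (Option.some_injective V), Finset.mem_image] at hm
  obtain ⟨m, hm, rfl⟩ := hm
  rw [Finsupp.degree_mapDomain]
  exact hf m hm

/-- Adjoin a variable to the polynomial ring. -/
@[reducible] noncomputable def baseChange (E : GradedResolution V k) :
    GradedResolution (Option V) k where
  ι := E.ι
  fintype := E.fintype
  deg := E.deg
  D i := (E.D i).map (rename some)
  homogeneous i c b := (E.homogeneous i c b).rename_some
  exact i v := by
    rw [exists_map_mulVec_iff, map_mulVec_eq_iff]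
    refine forall_congr' fun n => ?_
    rw [← E.exact]
    simp only [Pi.zero_apply, map_zero, Polynomial.coeff_zero]
    rfl

theorem IsMinimal.baseChange {E : GradedResolution V k} (hE : E.IsMinimal) :
    E.baseChange.IsMinimal := fun i c b =>
  (constantCoeff_rename some (E.D i c b)).trans (hE i c b)

theorem Resolves.baseChange {E : GradedResolution V k} {I : Ideal (MvPolynomial V k)}
    (hE : E.Resolves I) : E.baseChange.Resolves (extend I) := by
  obtain ⟨c₀, hu, hd, hI⟩ := hE
  refine ⟨c₀, hu, hd, fun f => ?_⟩
  have h1 := exists_map_mulVec_iff (E.D 0) fun _ => f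
  have h2 : ∀ {ψ : E.ι 0 → MvPolynomial (Option V) k}, ψ c₀ = f ↔ ψ = fun _ => f := fun {ψ} =>
    ⟨fun h => funext fun c => by rw [hu c, h], fun h => by rw [h]⟩
  have h3 : ∀ {ψ : E.ι 0 → MvPolynomial V k} {g}, ψ c₀ = g ↔ ψ = fun _ => g := fun {ψ g} =>
    ⟨fun h => funext fun c => by rw [hu c, h], fun h => by rw [h]⟩
  simp only [h2]
  rw [h1, mem_extend]
  refine forall_congr' fun n => ?_
  simp only [hI, h3]

end Extension

end GradedResolution

namespace GradedResolution

/-! ### The resolution of `I + zP` and the bound on the length of `K`. -/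

section Sup

variable {σ k : Type*} [Field k]

theorem constantCoeff_eq_zero_of_lt {a b : ℕ} (h : a < b) {f : MvPolynomial σ k}
    (hf : HomogeneousEntry a b f) : constantCoeff f = 0 := by
  by_contra h0
  have h1 := homogeneousEntry_iff.mp hf 0 h0
  simp only [map_zero] at h1
  omega

/-- The ideals `z I` and `I + z P` form the exact sequence `0 → I(-1) → I ⊕ P(-1) → I + z P → 0`,
and the mapping cone gives a minimal resolution of `I + z P`. -/
theorem exists_resolution_sup {I P : Ideal (MvPolynomial σ k)} {F K : GradedResolution σ k}
    (hF : F.Resolves I) (hK : K.Resolves P) (hIP : I ≤ P) (hFmin : F.IsMinimal)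
    (hKmin : K.IsMinimal) (hFdeg : ∀ i b, i + 2 ≤ F.deg (i + 1) b) (hKdeg : ∀ i b, K.deg i b = i)
    {z : MvPolynomial σ k} (hz : HomogeneousEntry 0 1 z) (hz0 : z ≠ 0)
    (hzI : ∀ f, z * f ∈ I → f ∈ I) :
    ∃ E : GradedResolution σ k, E.IsMinimal ∧ E.Resolves (I ⊔ Ideal.span {z} * P) ∧
      ∀ i j, (∃ b, E.deg i b = j) ↔ (∃ b, F.deg i b = j) ∨
        (0 < i ∧ Nonempty (K.ι i) ∧ j = i + 1) ∨
        ∃ i', i = i' + 2 ∧ ∃ b, F.deg (i' + 1) b + 1 = j := by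
  classical
  have hF' := hF
  obtain ⟨c₀, hu, hd, hI⟩ := hF'
  obtain ⟨c₁, -⟩ := hK.exists_index
  obtain ⟨θ, hθ0, hθh, hθc⟩ := hK.exists_lift hF (homogeneousEntry_one 0)
    fun f hf => by rw [one_mul]; exact hIP hf
  have hzc : constantCoeff z = 0 := constantCoeff_eq_zero_of_lt one_pos hz
  have hθv : ∀ u i, (θ 0 *ᵥ u) i = u c₀ := fun u i => by
    rw [hθ0, hF.const_mulVec 1 c₀ u i, one_mul]
  -- The lift of `f ↦ (zf, -f)`, the first map of the short exact sequence. Truncating `F` and `K`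
  -- gives resolutions of the ideals `I` and `P`.
  let Θ : ∀ i, Matrix ((F.tail.sum (K.tail.shift 1)).ι i) ((F.tail.shift 1).ι i)
    (MvPolynomial σ k) := fun i => fromRows (z • (1 : Matrix (F.ι (i + 1)) (F.ι (i + 1)) _))
      (-θ (i + 1))
  have hone : ∀ i (c b : F.ι i), HomogeneousEntry (F.deg i c) (F.deg i b + 1)
      ((z • (1 : Matrix (F.ι i) (F.ι i) (MvPolynomial σ k))) c b) := fun i c b => by
    rw [Matrix.smul_apply, Matrix.one_apply, smul_ite, smul_zero, smul_eq_mul, mul_one]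
    split_ifs with h
    · have h1 := hz.shift (F.deg i c)
      rw [zero_add, add_comm] at h1
      rw [← h]
      exact h1
    · exact homogeneousEntry_zero _ _
  have hΘ : IsChainMap (F.tail.shift 1) (F.tail.sum (K.tail.shift 1)) Θ := by
    refine ⟨fun i => ?_, fun i => ?_⟩
    · rintro (c | c) b
      · exact hone (i + 1) c b
      · exact (hθh (i + 1) c b).neg.shift 1
    · simp only [Θ]
      rw [fromBlocks_mul_fromRows, fromRows_mul]
      simp only [Matrix.mul_smul, Matrix.smul_mul, Matrix.mul_one, Matrix.one_mul, Matrix.zero_mul,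
        zero_add, add_zero, Matrix.mul_neg, Matrix.neg_mul, neg_zero, smul_zero, hθc]
  have hΘv : ∀ i u, Θ i *ᵥ u = Sum.elim (z • u) (-(θ (i + 1) *ᵥ u)) := fun i u => by
    simp only [Θ]
    rw [fromRows_mulVec, smul_mulVec, one_mulVec, neg_mulVec]
  have hinj : ∀ v, (∃ w, (F.tail.sum (K.tail.shift 1)).D 0 *ᵥ w = Θ 0 *ᵥ v) →
      ∃ w, (F.tail.shift 1).D 0 *ᵥ w = v := by
    rintro v ⟨w, hw⟩
    rw [hΘv, fromBlocks_mulVec, Sum.elim_eq_iff, zero_mulVec, add_zero] at hw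
    rw [← F.exact]
    have h1 : F.D 0 *ᵥ (z • v) = 0 := (F.exact 0 _).mpr ⟨_, hw.1⟩
    rw [mulVec_smul] at h1
    ext1 c
    exact (mul_eq_zero.mp (congrFun h1 c)).resolve_left hz0
  let G := cone (F.tail.sum (K.tail.shift 1)) (F.tail.shift 1) Θ hΘ hinj
  have hGv : ∀ (w : F.ι 2 → MvPolynomial σ k) (w' : K.ι 2 → MvPolynomial σ k)
      (u : F.ι 1 → MvPolynomial σ k), G.D 0 *ᵥ Sum.elim (Sum.elim w w') u =
      Sum.elim (F.D 1 *ᵥ w + z • u) (K.D 1 *ᵥ w' - θ 1 *ᵥ u) := fun w w' u => by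
    refine (cone_D_zero_mulVec _ _ Θ hΘ hinj (Sum.elim w w') u).trans ?_
    refine (congrArg₂ (· + ·) (fromBlocks_mulVec (F.D 1) 0 0 (K.D 1) (Sum.elim w w'))
      (hΘv 0 u)).trans ?_
    simp only [Sum.elim_comp_inl, Sum.elim_comp_inr, zero_mulVec, zero_add, add_zero,
      sub_eq_add_neg]
    exact (Sum.elim_add_add _ _ _ _).symm
  -- The map onto `I + zP` that sends `(f, p)` to `f + zp`, written on generators.
  let D₀ : Matrix (F.ι 0) (F.ι 1 ⊕ K.ι 1) (MvPolynomial σ k) :=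
    fromCols (F.D 0) (Matrix.of fun _ b => z * K.D 0 c₁ b)
  have hD₀v : ∀ (v : F.ι 1 → MvPolynomial σ k) (v' : K.ι 1 → MvPolynomial σ k) c,
      (D₀ *ᵥ Sum.elim v v') c = (F.D 0 *ᵥ v) c + z * (K.D 0 *ᵥ v') c₁ := fun v v' c => by
    simp only [D₀]
    rw [fromCols_mulVec_sumElim, Pi.add_apply]
    congr 1
    simp only [mulVec, dotProduct, of_apply, Finset.mul_sum, mul_assoc]
  have hD₀h : HomogeneousMatrix (F.deg 0) (G.deg 0) D₀ := by
    rintro c (b | b)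
    · exact F.homogeneous 0 c b
    · have h1 := K.homogeneous 0 c₁ b
      rw [hKdeg 0 c₁] at h1
      rw [hu c, hd]
      change HomogeneousEntry 0 (K.deg 1 b + 1) (z * K.D 0 c₁ b)
      rw [mul_comm]
      refine h1.mul ?_
      have h2 := hz.shift (K.deg 1 b)
      rwa [zero_add, add_comm] at h2
  have hexact : ∀ v, D₀ *ᵥ v = 0 ↔ ∃ w, G.D 0 *ᵥ w = v := by
    intro v
    obtain ⟨v, v', rfl⟩ : ∃ a b, v = Sum.elim a b := ⟨_, _, (Sum.elim_comp_inl_inr v).symm⟩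
    constructor
    · intro h
      have h0 : ∀ c, (F.D 0 *ᵥ v) c = -(z * (K.D 0 *ᵥ v') c₁) := fun c => by
        rw [eq_neg_iff_add_eq_zero, ← hD₀v, h, Pi.zero_apply]
      -- The intersection `I ∩ zP = zI`: from `f + zp = 0` follows `zp ∈ I`, so `p ∈ I`. Writing `p`
      -- as the image of `u` turns `v + zu` and `v' - θu` into cycles.
      have h1 : (K.D 0 *ᵥ v') c₁ ∈ I := by
        refine hzI _ ?_
        rw [← neg_mem_iff, ← h0 c₀]
        exact (hF.mem_iff c₀ _).mpr ⟨v, rfl⟩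
      obtain ⟨u, hu'⟩ := (hI _).mp h1
      obtain ⟨w, hw⟩ := (F.exact 0 (v + z • u)).mp (by
        ext1 c
        rw [mulVec_add, mulVec_smul, Pi.add_apply, Pi.smul_apply, h0 c, hu c, hu', smul_eq_mul,
          neg_add_cancel, Pi.zero_apply])
      obtain ⟨w', hw'⟩ := (K.exact 0 (v' - θ 1 *ᵥ u)).mp (by
        have h2 : ∀ c, (K.D 0 *ᵥ (v' - θ 1 *ᵥ u)) c = 0 := by
          intro c
          obtain ⟨c₂, hc₂⟩ := hK.exists_index
          rw [mulVec_sub, mulVec_mulVec, hθc, ← mulVec_mulVec, Pi.sub_apply, hθv, hu', hc₂ c,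
            ← hc₂ c₁, sub_self]
        exact funext h2)
      refine ⟨Sum.elim (Sum.elim w w') (-u), ?_⟩
      refine (hGv w w' (-u)).trans ?_
      rw [hw, hw', smul_neg, add_neg_cancel_right, mulVec_neg, sub_neg_eq_add, sub_add_cancel]
    · rintro ⟨w, hw⟩
      obtain ⟨w, w', u, rfl⟩ : ∃ (a : F.ι 2 → MvPolynomial σ k) (a' : K.ι 2 → MvPolynomial σ k)
          (b : F.ι 1 → MvPolynomial σ k), w = Sum.elim (Sum.elim a a') b :=
        ⟨_, _, _, (congrArg (fun x => Sum.elim x _) (Sum.elim_comp_inl_inr (w ∘ Sum.inl)) |>.trans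
          (Sum.elim_comp_inl_inr w)).symm⟩
      obtain ⟨rfl, rfl⟩ := Sum.elim_eq_iff.mp ((hGv w w' u).symm.trans hw)
      ext1 c
      rw [hD₀v]
      have h1 : F.D 0 *ᵥ (F.D 1 *ᵥ w) = 0 := (F.exact 0 _).mpr ⟨_, rfl⟩
      have h2 : K.D 0 *ᵥ (K.D 1 *ᵥ w') = 0 := (K.exact 0 _).mpr ⟨_, rfl⟩
      have h3 : (K.D 0 *ᵥ (θ 1 *ᵥ u)) c₁ = (F.D 0 *ᵥ u) c₀ := by
        rw [mulVec_mulVec, hθc, ← mulVec_mulVec, hθv]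
      rw [mulVec_add, mulVec_sub, h1, h2, zero_add, zero_sub, mulVec_smul, Pi.smul_apply,
        Pi.neg_apply, h3, hu c, smul_eq_mul, mul_neg, add_neg_cancel, Pi.zero_apply]
  refine ⟨G.cons inferInstance (F.deg 0) D₀ hD₀h hexact, ?_, ⟨c₀, hu, hd, fun f => ?_⟩, ?_⟩
  · have hone0 : ∀ i (c b : F.ι i),
        constantCoeff ((z • (1 : Matrix (F.ι i) (F.ι i) (MvPolynomial σ k))) c b) = 0 :=
      fun i c b => by rw [Matrix.smul_apply, smul_eq_mul, map_mul, hzc, zero_mul]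
    -- The degree gap gives minimality: `i + 1` in `K` against at least `i + 2` in `F`.
    have hθ1 : ∀ i c b, constantCoeff ((-θ (i + 1)) c b) = 0 := fun i c b => by
      rw [Matrix.neg_apply, map_neg, neg_eq_zero]
      refine constantCoeff_eq_zero_of_lt ?_ (hθh (i + 1) c b)
      rw [hKdeg]
      have := hFdeg i b
      change i + 1 < F.deg (i + 1) b + 0
      omega
    rintro (_ | _ | i) c b
    · obtain b | b := b
      · exact hFmin 0 c b
      · change constantCoeff (z * K.D 0 c₁ b) = 0
        rw [map_mul, hzc, zero_mul]
    · obtain (b | b) | b := b <;> obtain c | c := c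
      · exact hFmin 1 c b
      · exact map_zero _
      · exact map_zero _
      · exact hKmin 1 c b
      · exact hone0 1 c b
      · exact hθ1 0 c b
    · obtain (b | b) | b := b <;> obtain (c | c) | c := c
      · exact hFmin (i + 2) c b
      · exact map_zero _
      · exact map_zero _
      · exact map_zero _
      · exact hKmin (i + 2) c b
      · exact map_zero _
      · exact hone0 (i + 2) c b
      · exact hθ1 (i + 1) c b
      · change constantCoeff (-F.D (i + 1) c b) = 0
        rw [map_neg, hFmin, neg_zero]
  · change _ ↔ ∃ w, (D₀ *ᵥ w) c₀ = f
    rw [Submodule.mem_sup]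
    simp only [Ideal.mem_span_singleton_mul]
    constructor
    · rintro ⟨a, ha, -, ⟨p, hp, rfl⟩, rfl⟩
      obtain ⟨w, rfl⟩ := (hI a).mp ha
      obtain ⟨w', hw'⟩ := (hK.mem_iff c₁ fun _ => p).mp hp
      exact ⟨Sum.elim w w', by rw [hD₀v, hw']⟩
    · rintro ⟨w, rfl⟩
      obtain ⟨w, w', rfl⟩ : ∃ a b, w = Sum.elim a b := ⟨_, _, (Sum.elim_comp_inl_inr w).symm⟩
      exact ⟨_, (hI _).mpr ⟨w, rfl⟩, _, ⟨_, (hK.mem_iff c₁ _).mpr ⟨w', rfl⟩, rfl⟩,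
        (hD₀v w w' c₀).symm⟩
  · rintro (_ | _ | i) j
    · constructor
      · exact fun ⟨b, hb⟩ => Or.inl ⟨b, hb⟩
      · rintro (⟨b, hb⟩ | ⟨h, -⟩ | ⟨i', h, -⟩)
        · exact ⟨b, hb⟩
        · omega
        · omega
    · constructor
      · rintro ⟨b | b, hb⟩
        · exact Or.inl ⟨b, hb⟩
        · refine Or.inr (Or.inl ⟨one_pos, ⟨b⟩, hb.symm.trans ?_⟩)
          exact congrArg (· + 1) (hKdeg 1 b)
      · rintro (⟨b, hb⟩ | ⟨-, ⟨b⟩, rfl⟩ | ⟨i', h, -⟩)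
        · exact ⟨Sum.inl b, hb⟩
        · exact ⟨Sum.inr b, congrArg (· + 1) (hKdeg 1 b)⟩
        · omega
    · constructor
      · rintro ⟨(b | b) | b, hb⟩
        · exact Or.inl ⟨b, hb⟩
        · refine Or.inr (Or.inl ⟨Nat.succ_pos _, ⟨b⟩, hb.symm.trans ?_⟩)
          exact congrArg (· + 1) (hKdeg _ b)
        · exact Or.inr (Or.inr ⟨i, rfl, b, hb⟩)
      · rintro (⟨b, hb⟩ | ⟨-, ⟨b⟩, rfl⟩ | ⟨i', h, b, hb⟩)
        · exact ⟨Sum.inl (Sum.inl b), hb⟩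
        · exact ⟨Sum.inl (Sum.inr b), congrArg (· + 1) (hKdeg _ b)⟩
        · obtain rfl : i = i' := by omega
          exact ⟨Sum.inr b, hb⟩

/-- If `u P ≤ I ≤ P` for some homogeneous `u` outside `P`, and `P` has a free resolution with
differentials in `P`, then a resolution of `I` is at least as long as that of `P`. -/
theorem nonempty_index {I P : Ideal (MvPolynomial σ k)} {F K : GradedResolution σ k}
    (hF : F.Resolves I) (hK : K.Resolves P) (hKD : ∀ i c b, K.D i c b ∈ P) (hIP : I ≤ P)
    {u : MvPolynomial σ k} {s : ℕ} (hu : HomogeneousEntry 0 s u) (huP : u ∉ P)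
    (hu' : ∀ f ∈ P, u * f ∈ I) {i : ℕ} (hi : Nonempty (K.ι i)) : Nonempty (F.ι i) := by
  classical
  by_contra hempty
  rw [not_nonempty_iff] at hempty
  obtain ⟨c, -⟩ := hF.exists_index
  obtain ⟨c', -⟩ := hK.exists_index
  obtain ⟨φ, hφ0, -, hφ⟩ := hF.exists_lift hK hu hu'
  obtain ⟨ψ, hψ0, -, hψ⟩ := hK.exists_lift hF (homogeneousEntry_one 0)
    fun f hf => by rw [one_mul]; exact hIP hf
  obtain ⟨b⟩ := hi
  -- `ψφ` and multiplication by `u` lift the same endomorphism of `R/P`, so they differ by entries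
  -- in `P`. When `F.ι i` is empty, `ψφ` vanishes in degree `i`, and a diagonal entry shows `u ∈ P`.
  have key := entries_mem_of_null K K
    (fun i => ψ i * φ i - u • (1 : Matrix (K.ι i) (K.ι i) (MvPolynomial σ k))) (fun i => by
      rw [Matrix.mul_sub, Matrix.sub_mul, ← Matrix.mul_assoc, hψ, Matrix.mul_assoc, hφ,
        Matrix.mul_assoc, Matrix.mul_smul, Matrix.smul_mul, Matrix.mul_one, Matrix.one_mul])
    P hKD hKD (fun v => by
      rw [← hK.mem_iff c', Matrix.sub_mulVec, ← mulVec_mulVec, Pi.sub_apply, hψ0, hφ0,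
        hF.const_mulVec 1 c, hK.const_mulVec u c', one_mul, smul_mulVec, one_mulVec, Pi.smul_apply,
        smul_eq_mul, sub_self]
      exact P.zero_mem) i b b
  rw [Matrix.sub_apply, Matrix.mul_apply, Finset.univ_eq_empty, Finset.sum_empty, zero_sub,
    neg_mem_iff, Matrix.smul_apply, Matrix.one_apply_eq, smul_eq_mul, mul_one] at key
  exact huP key

/-- In a minimal resolution no column vanishes and no entry has a constant term, so degrees rise by
at least one at each step, starting from the generators of `I` in degree at least two. -/
theorem IsMinimal.le_deg {F : GradedResolution σ k} (hF : F.IsMinimal) {I : Ideal (MvPolynomial σ k)}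
    (hI : F.Resolves I) (hdeg : ∀ f ∈ I, ∀ m ∈ f.support, 2 ≤ m.degree) (i : ℕ) :
    ∀ b, i + 2 ≤ F.deg (i + 1) b := by
  classical
  have hcol : ∀ i (b : F.ι (i + 1)), ∃ c, F.D i c b ≠ 0 := by
    intro i b
    by_contra! h
    obtain ⟨w, hw⟩ := (F.exact i (Pi.single b 1)).mp (by
      rw [mulVec_single_one]
      exact funext h)
    have h1 := congrArg constantCoeff (congrFun hw b)
    rw [Pi.single_eq_same, map_one, mulVec, dotProduct, map_sum] at h1
    rw [Finset.sum_eq_zero fun x _ => by rw [map_mul, hF, zero_mul]] at h1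
    exact zero_ne_one h1
  induction i with
  | zero =>
    intro b
    obtain ⟨c, hc⟩ := hcol 0 b
    obtain ⟨m, hm⟩ := MvPolynomial.support_nonempty.mpr hc
    have h1 : F.D 0 c b ∈ I := by
      have h2 := (hI.mem_iff c (F.D 0 *ᵥ Pi.single b 1)).mpr ⟨_, rfl⟩
      rwa [mulVec_single_one] at h2
    have h3 := F.homogeneous 0 c b m hm
    have h4 := hdeg _ h1 m hm
    omega
  | succ i ih =>
    intro b
    obtain ⟨c, hc⟩ := hcol (i + 1) b
    obtain ⟨m, hm⟩ := MvPolynomial.support_nonempty.mpr hc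
    have h3 := F.homogeneous (i + 1) c b m hm
    have h4 := ih c
    have h5 : m ≠ 0 := by
      rintro rfl
      exact mem_support_iff.mp hm (hF (i + 1) c b)
    have h6 : m.degree ≠ 0 := fun h => h5 ((Finsupp.degree_eq_zero_iff m).mp h)
    omega

end Sup

end GradedResolution

/-! ### Edge ideals, the suspension and minimal vertex covers. -/

section EdgeIdeal

variable {V k : Type*} [Field k]

/-- In this form membership can be tested on one monomial at a time. -/
theorem edgeIdeal_eq_span_monomial (G : SimpleGraph V) :
    G.edgeIdeal k = Ideal.span ((fun t => monomial t 1) ''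
      {t : V →₀ ℕ | ∃ i j, G.Adj i j ∧ t = Finsupp.single i 1 + Finsupp.single j 1}) := by
  rw [SimpleGraph.edgeIdeal]
  congr 1
  ext f
  have h : ∀ i j : V, (X i * X j : MvPolynomial V k) =
      monomial (Finsupp.single i 1 + Finsupp.single j 1) 1 := fun i j => by
    rw [X, X, monomial_mul, one_mul]
  constructor
  · rintro ⟨i, j, hij, rfl⟩
    exact ⟨_, ⟨i, j, hij, rfl⟩, (h i j).symm⟩
  · rintro ⟨_, ⟨i, j, hij, rfl⟩, rfl⟩
    exact ⟨i, j, hij, (h i j).symm⟩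

theorem edgeIdeal_homogeneousComponent (G : SimpleGraph V) (f : MvPolynomial V k)
    (hf : f ∈ G.edgeIdeal k) (n : ℕ) : homogeneousComponent n f ∈ G.edgeIdeal k := by
  rw [edgeIdeal_eq_span_monomial, mem_ideal_span_monomial_image] at *
  intro m hm
  refine hf m ?_
  rw [mem_support_iff, coeff_homogeneousComponent] at hm
  rw [mem_support_iff]
  exact fun h => hm (by rw [h, ite_self])

theorem two_le_degree_of_mem_edgeIdeal (G : SimpleGraph V) (f : MvPolynomial V k)
    (hf : f ∈ G.edgeIdeal k) (m : V →₀ ℕ) (hm : m ∈ f.support) : 2 ≤ m.degree := by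
  rw [edgeIdeal_eq_span_monomial, mem_ideal_span_monomial_image] at hf
  obtain ⟨_, ⟨i, j, -, rfl⟩, hle⟩ := hf m hm
  have h := Finsupp.degree_mono hle
  rw [map_add, Finsupp.degree_single, Finsupp.degree_single] at h
  exact h

theorem edgeIdeal_ne_top (G : SimpleGraph V) : G.edgeIdeal k ≠ ⊤ := by
  classical
  intro h
  have h1 := two_le_degree_of_mem_edgeIdeal G 1 ((Ideal.eq_top_iff_one _).mp h) 0 (by
    rw [mem_support_iff, coeff_zero_one]
    exact one_ne_zero)
  rw [map_zero] at h1
  omega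

theorem X_mul_X_mem_edgeIdeal {G : SimpleGraph V} {i j : V} (h : G.Adj i j) :
    (X i * X j : MvPolynomial V k) ∈ G.edgeIdeal k :=
  Ideal.subset_span ⟨i, j, h, rfl⟩

theorem edgeIdeal_le_span_X {G : SimpleGraph V} {C : Set V} (hC : G.IsVertexCover C) :
    G.edgeIdeal k ≤ Ideal.span (X '' C) := by
  refine Ideal.span_le.mpr ?_
  rintro _ ⟨i, j, hij, rfl⟩
  obtain h | h := hC hij
  · exact Ideal.mul_mem_right _ _ (Ideal.subset_span ⟨i, h, rfl⟩)
  · exact Ideal.mul_mem_left _ _ (Ideal.subset_span ⟨j, h, rfl⟩)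

theorem edgeIdeal_suspension (G : SimpleGraph V) (C : Set V) :
    (G.suspension C).edgeIdeal k = GradedResolution.extend (G.edgeIdeal k) ⊔
      Ideal.span {X none} * GradedResolution.extend (Ideal.span (X '' C)) := by
  have hz : ∀ v ∈ C, (X none * X (some v) : MvPolynomial (Option V) k) ∈
      GradedResolution.extend (G.edgeIdeal k) ⊔
        Ideal.span {X none} * GradedResolution.extend (Ideal.span (X '' C)) := fun v hv => by
    refine Ideal.mem_sup_right (Ideal.mul_mem_mul (Ideal.mem_span_singleton_self _) ?_)
    rw [← rename_X]
    exact GradedResolution.rename_mem_extend (Ideal.subset_span ⟨v, hv, rfl⟩)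
  refine le_antisymm (Ideal.span_le.mpr ?_) (sup_le (GradedResolution.extend_le fun f hf => ?_) ?_)
  · rintro _ ⟨_ | i, _ | j, hij, rfl⟩
    · exact hij.elim
    · exact hz j hij
    · rw [mul_comm (X (some i))]
      exact hz i hij
    · refine Ideal.mem_sup_left ?_
      rw [← rename_X, ← rename_X, ← map_mul]
      exact GradedResolution.rename_mem_extend (X_mul_X_mem_edgeIdeal hij)
  · have h : G.edgeIdeal k ≤ ((G.suspension C).edgeIdeal k).comap (rename some) := by
      refine Ideal.span_le.mpr ?_
      rintro _ ⟨i, j, hij, rfl⟩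
      change rename some (X i * X j) ∈ (G.suspension C).edgeIdeal k
      rw [map_mul, rename_X, rename_X]
      exact X_mul_X_mem_edgeIdeal hij
    exact h hf
  · rw [Ideal.span_singleton_mul_le_iff]
    intro f hf
    -- The colon ideal of the edge ideal of the suspension by `z`; it suffices that it contains the
    -- variables in `C`.
    let Q : Ideal (MvPolynomial (Option V) k) := Submodule.comap
      (LinearMap.mulLeft (MvPolynomial (Option V) k) (X none)) ((G.suspension C).edgeIdeal k)
    have h : GradedResolution.extend (Ideal.span (X '' C)) ≤ Q := by
      refine GradedResolution.extend_le fun f hf => ?_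
      have h1 : Ideal.span (X '' C) ≤ Q.comap (rename some : MvPolynomial V k →ₐ[k] _) := by
        refine Ideal.span_le.mpr ?_
        rintro _ ⟨v, hv, rfl⟩
        change X none * rename some (X v) ∈ (G.suspension C).edgeIdeal k
        rw [rename_X]
        exact X_mul_X_mem_edgeIdeal (show (G.suspension C).Adj none (some v) from hv)
      exact h1 hf
    exact h hf

/-- If all neighbours of `c` lay in `C`, then `C \ {c}` would still be a cover. -/
theorem exists_adj_notMem {G : SimpleGraph V} {C : Set V} (hC : Minimal G.IsVertexCover C) {c : V}
    (hc : c ∈ C) : ∃ v, G.Adj c v ∧ v ∉ C := by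
  by_contra! h
  have h1 : G.IsVertexCover (C \ {c}) := by
    have key : ∀ v w, G.Adj v w → v ∈ C → v ∈ C \ {c} ∨ w ∈ C \ {c} := by
      intro v w hvw hv
      by_cases hvc : v = c
      · subst hvc
        exact Or.inr ⟨h w hvw, hvw.ne'⟩
      · exact Or.inl ⟨hv, hvc⟩
    intro v w hvw
    obtain hv | hw := hC.prop hvw
    · exact key v w hvw hv
    · exact (key w v hvw.symm hw).symm
  exact (hC.le_of_le h1 Set.sdiff_subset hc).2 rfl

/-- The product of the variables outside a minimal vertex cover multiplies the prime of the cover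
into the edge ideal. -/
theorem exists_multiplier [Fintype V] {G : SimpleGraph V} {C : Set V}
    (hC : Minimal G.IsVertexCover C) : ∃ (u : MvPolynomial V k) (s : ℕ), HomogeneousEntry 0 s u ∧
      u ∉ Ideal.span (X '' C) ∧ ∀ f ∈ Ideal.span (X '' C), u * f ∈ G.edgeIdeal k := by
  classical
  refine ⟨(∏ v ∈ Finset.univ.filter (· ∉ C), X v), ∑ v ∈ Finset.univ.filter (· ∉ C), 1,
    fun m hm => ?_, fun h => ?_, fun f hf => ?_⟩
  · have h := IsHomogeneous.prod (Finset.univ.filter (· ∉ C)) (X (R := k)) _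
      (fun v _ => isHomogeneous_X k v)
    rw [zero_add, Finsupp.degree_eq_weight_one]
    exact h (mem_support_iff.mp hm)
  · have key : ∀ s : Finset V, (∀ v ∈ s, v ∉ C) →
        ∏ v ∈ s, (X v : MvPolynomial V k) ∉ Ideal.span (X '' C) := by
      intro s
      induction s using Finset.induction_on with
      | empty =>
        intro _ h
        rw [Finset.prod_empty, mem_ideal_span_X_image] at h
        obtain ⟨i, -, hi⟩ := h 0 (by
          rw [mem_support_iff, coeff_zero_one]
          exact one_ne_zero)
        exact hi rfl
      | insert v s hv ih =>
        intro hs h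
        rw [Finset.prod_insert hv] at h
        exact ih (fun w hw => hs w (Finset.mem_insert_of_mem hw))
          (GradedResolution.mem_span_X_of_mul (hs v (Finset.mem_insert_self v s)) h)
    exact key _ (fun v hv => (Finset.mem_filter.mp hv).2) h
  · induction hf using Submodule.span_induction with
    | mem f hf =>
      obtain ⟨c, hc, rfl⟩ := hf
      obtain ⟨v, hcv, hv⟩ := exists_adj_notMem hC hc
      -- A neighbour `v` of `c` outside `C` divides the product, so the product times `X c` is a
      -- multiple of the edge monomial.
      obtain ⟨g, hg⟩ := Finset.dvd_prod_of_mem (X : V → MvPolynomial V k)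
        (show v ∈ Finset.univ.filter (· ∉ C) by simpa using hv)
      rw [hg, mul_right_comm]
      exact Ideal.mul_mem_right _ _ (X_mul_X_mem_edgeIdeal hcv.symm)
    | zero => simp
    | add f g _ _ hf hg => rw [mul_add]; exact Ideal.add_mem _ hf hg
    | smul a f _ hf => rw [smul_eq_mul, mul_left_comm]; exact Ideal.mul_mem_left _ _ hf

/-- A minimal resolution is no larger than the finite one obtained from iterated cones; this makes
the maxima in the theorem exist. -/
theorem exists_isEmpty_of_resolves_edgeIdeal [Finite V] {G : SimpleGraph V}
    {F : GradedResolution V k} (hF : F.IsMinimal) (hI : F.Resolves (G.edgeIdeal k)) :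
    ∃ N, ∀ i, N < i → IsEmpty (F.ι i) := by
  classical
  have hfin : {t : V →₀ ℕ | ∃ i j, G.Adj i j ∧
      t = Finsupp.single i 1 + Finsupp.single j 1}.Finite := by
    refine (Set.finite_range fun p : V × V => Finsupp.single p.1 1 + Finsupp.single p.2 1).subset ?_
    rintro _ ⟨i, j, -, rfl⟩
    exact ⟨(i, j), rfl⟩
  obtain ⟨E, N, hE, hN⟩ := GradedResolution.exists_finite_resolution k _ hfin.toFinset le_rfl
  rw [Set.Finite.coe_toFinset, ← edgeIdeal_eq_span_monomial] at hE
  refine ⟨N, fun i hi => ⟨fun b => ?_⟩⟩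
  have := hN i hi
  have h := hF.card_le (edgeIdeal_homogeneousComponent G) hI.augments hE.augments i (F.deg i b)
  have h1 : 0 < Nat.card {b' : F.ι i // F.deg i b' = F.deg i b} :=
    Nat.card_pos_iff.mpr ⟨⟨⟨b, rfl⟩⟩, inferInstance⟩
  rw [Nat.card_of_isEmpty (α := {c // E.deg i c = F.deg i b})] at h
  omega

end EdgeIdeal

end GradedBetti

/-! ### The main theorem: comparing the degrees in the two minimal resolutions. -/

theorem theorem3p3 {V : Type*} [Fintype V] [Nonempty V] (k : Type*) [Field k]
    (G : SimpleGraph V) (hG : ∀ v, ¬ G.IsIsolated v)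
    (C : Set V) (hC : Minimal G.IsVertexCover C) :
    (∃ r : ℤ, GradedBetti.HasRegularity (G.edgeIdeal k) r ∧
      GradedBetti.HasRegularity ((G.suspension C).edgeIdeal k) r) ∧
    (∃ p : ℕ, GradedBetti.HasPdim (G.edgeIdeal k) p ∧
      GradedBetti.HasPdim ((G.suspension C).edgeIdeal k) (p + 1)) := by
  classical
  obtain ⟨F, hFmin, hF⟩ := GradedBetti.exists_minimal_resolution
    (GradedBetti.edgeIdeal_homogeneousComponent (k := k) G) (GradedBetti.edgeIdeal_ne_top G)
  obtain ⟨K, hK, hKdeg, hKD⟩ := GradedBetti.GradedResolution.exists_koszul k C.toFinset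
  rw [Set.coe_toFinset] at hK hKD
  have hle := GradedBetti.edgeIdeal_le_span_X (k := k) hC.prop
  have hFdeg := hFmin.le_deg hF (GradedBetti.two_le_degree_of_mem_edgeIdeal G)
  have hKmin : K.IsMinimal := fun i c b => GradedBetti.GradedResolution.constantCoeff_eq_zero_of_lt
    (by rw [hKdeg, hKdeg]; omega) (K.homogeneous i c b)
  have hX : GradedBetti.HomogeneousEntry 0 1 (MvPolynomial.X none : MvPolynomial (Option V) k) := by
    have h := GradedBetti.GradedResolution.homogeneousEntry_monomial
      (Finsupp.single (none : Option V) 1) (1 : k)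
    rwa [Finsupp.degree_single] at h
  obtain ⟨E, hEmin, hE, hEdeg⟩ := GradedBetti.GradedResolution.exists_resolution_sup hF.baseChange hK.baseChange
    (Ideal.comap_mono (Ideal.map_mono hle)) hFmin.baseChange hKmin.baseChange hFdeg hKdeg hX
    (MvPolynomial.X_ne_zero none) fun f => GradedBetti.GradedResolution.mem_extend_of_X_mul
  rw [← GradedBetti.edgeIdeal_suspension] at hE
  have hKF : ∀ i, Nonempty (K.ι i) → Nonempty (F.ι i) := fun i hi => by
    obtain ⟨u, s, hu, huP, hu'⟩ := GradedBetti.exists_multiplier (k := k) hC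
    exact GradedBetti.GradedResolution.nonempty_index hF hK hKD hle hu huP hu' hi
  -- An edge makes `I` nonzero, so `F_1 ≠ 0`. This gives both `reg R/I ≥ 1` and `pdim R/I ≥ 1`.
  obtain ⟨b₁⟩ : Nonempty (F.ι 1) := by
    obtain ⟨v⟩ := ‹Nonempty V›
    obtain ⟨w, hw⟩ : ∃ w, G.Adj v w := by
      by_contra! h
      exact hG v h
    by_contra hempty
    rw [not_nonempty_iff] at hempty
    obtain ⟨c, -⟩ := hF.exists_index
    obtain ⟨t, ht⟩ := (hF.mem_iff c fun _ => MvPolynomial.X v * MvPolynomial.X w).mp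
      (GradedBetti.X_mul_X_mem_edgeIdeal hw)
    rw [Subsingleton.elim t 0, Matrix.mulVec_zero] at ht
    exact mul_ne_zero (MvPolynomial.X_ne_zero v) (MvPolynomial.X_ne_zero w) (congrFun ht c).symm
  have hb₁ : 2 ≤ F.deg 1 b₁ := hFdeg 0 b₁
  obtain ⟨N, hN⟩ := GradedBetti.exists_isEmpty_of_resolves_edgeIdeal hFmin hF
  have hlt : ∀ i, F.ι i → i ≤ N := fun i b => by
    by_contra h
    exact (hN i (not_le.mp h)).elim b
  have hbF := hFmin.betti_ne_zero_iff (GradedBetti.edgeIdeal_homogeneousComponent G) hF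
  have hbE := hEmin.betti_ne_zero_iff (GradedBetti.edgeIdeal_homogeneousComponent _) hE
  simp only [GradedBetti.HasRegularity, GradedBetti.HasPdim, hbF, hbE, hEdeg]
  constructor
  · let A : Set ((i : Fin (N + 1)) × F.ι i) := Set.univ
    obtain ⟨⟨i₀, b₀⟩, -, hmax⟩ := Set.exists_max_image A
      (fun p => (F.deg p.1 p.2 : ℤ) - (p.1 : ℕ)) Set.finite_univ
      ⟨⟨⟨1, by have := hlt 1 b₁; omega⟩, b₁⟩, trivial⟩
    have hmax' : ∀ i (b : F.ι i), (F.deg i b : ℤ) - i ≤ (F.deg i₀ b₀ : ℤ) - (i₀ : ℕ) := fun i b =>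
      hmax ⟨⟨i, Nat.lt_succ_of_le (hlt i b)⟩, b⟩ trivial
    refine ⟨(F.deg i₀ b₀ : ℤ) - (i₀ : ℕ), ⟨⟨i₀, _, ⟨b₀, rfl⟩, rfl⟩, ?_⟩,
      ⟨⟨i₀, _, Or.inl ⟨b₀, rfl⟩, rfl⟩, ?_⟩⟩
    · rintro _ ⟨i, _, ⟨b, rfl⟩, rfl⟩
      exact hmax' i b
    · rintro _ ⟨i, j, ⟨b, rfl⟩ | ⟨-, -, rfl⟩ | ⟨i', rfl, b, rfl⟩, rfl⟩
      · exact hmax' i b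
      -- The Koszul summand contributes `j - i = 1`, and `b₁` already contributes at least `1`.
      · have := hmax' 1 b₁
        push_cast at this ⊢
        omega
      -- Both the homological degree and the internal degree rise by one, so `j - i` is unchanged.
      · have := hmax' (i' + 1) b
        push_cast at this ⊢
        omega
  · have hex : ∃ p, Nonempty (F.ι p) ∧ ∀ i, Nonempty (F.ι i) → i ≤ p :=
      ⟨Nat.findGreatest (fun i => Nonempty (F.ι i)) N,
        Nat.findGreatest_spec (P := fun i => Nonempty (F.ι i)) (hlt 1 b₁) ⟨b₁⟩,
        fun i hi => Nat.le_findGreatest (hlt i hi.some) hi⟩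
    obtain ⟨p, ⟨b₀⟩, hmax⟩ := hex
    have hp : 1 ≤ p := hmax 1 ⟨b₁⟩
    refine ⟨p, ⟨⟨_, b₀, rfl⟩, ?_⟩, ⟨?_, ?_⟩⟩
    · rintro i ⟨_, b, rfl⟩
      exact hmax i ⟨b⟩
    -- The shifted copy of `F` begins with `F_1` in homological degree two, so `p ≥ 1` is needed to
    -- find the top module `F_p` in degree `p + 1`.
    · obtain ⟨q, rfl⟩ : ∃ q, p = q + 1 := ⟨p - 1, by omega⟩
      exact ⟨_, Or.inr (Or.inr ⟨q, rfl, b₀, rfl⟩)⟩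
    · rintro i ⟨j, ⟨b, rfl⟩ | ⟨-, h, rfl⟩ | ⟨i', rfl, b, rfl⟩⟩
      · exact (hmax i ⟨b⟩).trans p.le_succ
      · exact (hmax i (hKF i h)).trans p.le_succ
      · have := hmax (i' + 1) ⟨b⟩
        omega
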